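/- Let $(\Gamma,G,\partial,*)$ be a crossed module of Lie groups with $\Gamma$ discrete and $G$ finite-dimensional, connected and simply connected: $\partial:\Gamma\to G$ is a homomorphism, $(x,\gamma)\mapsto x*\gamma$ is a smooth left action of $G$ on $\Gamma$ by automorphisms, $\partial(x*\gamma)=x\,\partial(\gamma)\,x^{-1}$ and $\partial(\gamma)*\gamma'=\gamma\gamma'\gamma^{-1}$. Let $\mathcal G$ be the differentiable stack presented by the translation groupoid $\Gamma\ltimes G\rightrightarrows G$ of the action $\gamma\cdot x=\partial(\gamma)x$, with atlas $p:G\to\mathcal G$ and unit $1:\star\to G\to\mathcal G$. Thus a map $M\to\mathcal G$ from a manifold is given by a principal right $\Gamma$-bundle $a:E\to M$ with a smooth map $b:E\to G$ such that $b(e\cdot\gamma)=\partial(\gamma)^{-1}b(e)$, and 2-isomorphisms are equivariant bundle isomorphisms commuting with the maps $b$. A \emph{loop} is a map $\ell:S^1\to\mathcal G$ whose restriction to the base point $1\in S^1$ is 2-isomorphic to the unit. Two loops $\ell_0,\ell_1$ are \emph{homotopic} if there is a map $F:S^1\times\mathbb R\to\mathcal G$ such that $F(1,\cdot)$ is 2-isomorphic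 to the constant map at the unit and $F(\cdot,i)$ is 2-isomorphic to $\ell_i$ for $i=0,1$. Let $\pi_1(\mathcal G)$ be the set of homotopy classes of loops. A \emph{lift through the unit} of a loop $\ell=(E,a,b)$ is a smooth map $\lambda:\mathbb R\to E=S^1\times_{\mathcal G}G$ with $a(\lambda(t))=e^{2\pi i t}$ for all $t$ and $b(\lambda(0))=1$; its \emph{$\Gamma$-difference} $\lambda(0)^{-1}\lambda(1)$ is the unique $\gamma\in\Gamma$ with $\lambda(1)=\lambda(0)\cdot\gamma$. Then homotopy is an equivalence relation on loops; every class in $\pi_1(\mathcal G)$ has a representative that is constant near the base point (that is, whose restriction to some open neighbourhood of $1\in S^1$ is 2-isomorphic to the constant map at the unit), any two such representatives can be concatenated, and concatenation of loops induces a group structure on $\pi_1(\mathcal G)$. Every loop has a lift through the unit, and the $\Gamma$-difference of such a lift depends neither on the lift nor on the representative of the homotopy class, so that $$\partial_1:\pi_1(\mathcal G)\to\Gamma,\qquad \partial_1([\ell])=\lambda(0)^{-1}\lambda(1)\quad(\lambda\text{ any lift of }\ell\text{ through the unit})$$ is a well-defined map. It is bijective and a homomorphism of groups, hence an isomorphism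 of groups. -/

import Mathlib

open scoped Manifold ContDiff

universe u v w

noncomputable section

/-! ### Manifolds étale over a manifold -/

section Etale

variable {B : Type*} [NormedAddCommGroup B] [NormedSpace ℝ B]
  {H : Type*} [TopologicalSpace H] {I : ModelWithCorners ℝ B H}
  {M : Type*} [TopologicalSpace M] [ChartedSpace H M]
  {E : Type*} [TopologicalSpace E]

/-- The charted space structure on the source of a local homeomorphism `a : E → M` whose charts
are the charts of `M` composed with the local restrictions of `a`. -/
@[reducible] def etaleChartedSpace (a : E → M) (ha : IsLocalHomeomorph a) : ChartedSpace H E where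
  atlas := {c | ∃ φ : OpenPartialHomeomorph E M, (∀ e ∈ φ.source, φ e = a e) ∧
    ∃ d ∈ atlas H M, c = φ.trans d}
  chartAt e := (ha e).choose.trans (chartAt H (a e))
  mem_chart_source e := by
    have h := (ha e).choose_spec
    rw [OpenPartialHomeomorph.trans_source]
    refine ⟨h.1, ?_⟩
    rw [Set.mem_preimage, ← h.2]
    exact mem_chart_source H (a e)
  chart_mem_atlas e :=
    ⟨(ha e).choose, fun x _ => (congrFun (ha e).choose_spec.2 x).symm, _,
      chart_mem_atlas H (a e), rfl⟩

theorem etale_isManifold [IsManifold I ∞ M] (a : E → M) (ha : IsLocalHomeomorph a) :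
    @IsManifold ℝ _ B _ _ H _ I ∞ E _ (etaleChartedSpace a ha) := by
  let : ChartedSpace H E := etaleChartedSpace a ha
  have : HasGroupoid E (contDiffGroupoid ∞ I) := by
    constructor
    rintro c c' ⟨φ, hφ, d, hd, rfl⟩ ⟨φ', hφ', d', hd', rfl⟩
    have hdd := (contDiffGroupoid ∞ I).compatible hd hd'
    have hs : IsOpen ((φ.trans d).symm.trans (φ'.trans d')).source :=
      OpenPartialHomeomorph.open_source _
    refine (contDiffGroupoid ∞ I).mem_of_eqOnSource
      (closedUnderRestriction' hdd hs) ⟨?_, ?_⟩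
    · rw [OpenPartialHomeomorph.restr_source' _ _ hs]
      ext y
      constructor
      · intro hy
        refine ⟨?_, hy⟩
        simp only [OpenPartialHomeomorph.trans_source, OpenPartialHomeomorph.symm_source,
          OpenPartialHomeomorph.trans_target, Set.mem_inter_iff, Set.mem_preimage,
          OpenPartialHomeomorph.coe_trans_symm, Function.comp_apply] at hy ⊢
        obtain ⟨⟨h1, h2⟩, h3, h4⟩ := hy
        rw [hφ' _ h3, ← hφ _ (φ.map_target h2), φ.right_inv h2] at h4
        exact ⟨h1, h4⟩
      · exact fun hy => hy.2
    · intro y hy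
      simp only [OpenPartialHomeomorph.trans_source, OpenPartialHomeomorph.symm_source,
          OpenPartialHomeomorph.trans_target, Set.mem_inter_iff, Set.mem_preimage,
          OpenPartialHomeomorph.coe_trans_symm, Function.comp_apply] at hy
      obtain ⟨⟨h1, h2⟩, h3, h4⟩ := hy
      simp only [OpenPartialHomeomorph.coe_trans, OpenPartialHomeomorph.coe_trans_symm,
        Function.comp_apply, OpenPartialHomeomorph.restr_apply]
      rw [hφ' _ h3, ← hφ _ (φ.map_target h2), φ.right_inv h2]
  exact IsManifold.mk' I ∞ E

theorem etale_isLocalDiffeomorph [IsManifold I ∞ M] (a : E → M) (ha : IsLocalHomeomorph a) :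
    @IsLocalDiffeomorph ℝ _ B _ _ B _ _ H _ H _ I I E _ (etaleChartedSpace a ha) M _ _ ∞ a := by
  let : ChartedSpace H E := etaleChartedSpace a ha
  have : IsManifold I ∞ E := etale_isManifold a ha
  intro e
  obtain ⟨φ, he, hφ⟩ := ha e
  have hφ' : ∀ x ∈ φ.source, φ x = a x := fun x _ => (congrFun hφ x).symm
  have hmem : ∀ x : M, φ.trans (chartAt H x) ∈ IsManifold.maximalAtlas I ∞ E := fun x =>
    IsManifold.subset_maximalAtlas ⟨φ, hφ', _, chart_mem_atlas H x, rfl⟩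
  refine ⟨{ toPartialEquiv := φ.toPartialEquiv
            open_source := φ.open_source
            open_target := φ.open_target
            contMDiffOn_toFun := ?_
            contMDiffOn_invFun := ?_ }, he, fun x _ => congrFun hφ x⟩
  · intro x hx
    apply ContMDiffAt.contMDiffWithinAt
    have hx' : x ∈ (φ.trans (chartAt H (φ x))).source := by
      rw [OpenPartialHomeomorph.trans_source]
      exact ⟨hx, mem_chart_source H (φ x)⟩
    have h1 := contMDiffAt_of_mem_maximalAtlas (hmem (φ x)) hx'
    have h2 : ContMDiffAt I I ∞ (chartAt H (φ x)).symm ((φ.trans (chartAt H (φ x))) x) :=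
      contMDiffAt_symm_of_mem_maximalAtlas
        (IsManifold.chart_mem_maximalAtlas (φ x)) (mem_chart_target H (φ x))
    refine (ContMDiffAt.comp x h2 h1).congr_of_eventuallyEq ?_
    filter_upwards [(φ.trans (chartAt H (φ x))).open_source.mem_nhds hx'] with y hy
    rw [OpenPartialHomeomorph.trans_source] at hy
    exact ((chartAt H (φ x)).left_inv hy.2).symm
  · intro y hy
    apply ContMDiffAt.contMDiffWithinAt
    have hy' : (chartAt H y) y ∈ (φ.trans (chartAt H y)).target := by
      rw [OpenPartialHomeomorph.trans_target]
      refine ⟨mem_chart_target H y, ?_⟩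
      rw [Set.mem_preimage, (chartAt H y).left_inv (mem_chart_source H y)]
      exact hy
    have h1 : ContMDiffAt I I ∞ (chartAt H y) y :=
      contMDiffAt_of_mem_maximalAtlas (IsManifold.chart_mem_maximalAtlas y)
        (mem_chart_source H y)
    have h2 := contMDiffAt_symm_of_mem_maximalAtlas (hmem y) hy'
    refine (ContMDiffAt.comp y h2 h1).congr_of_eventuallyEq ?_
    filter_upwards [(chartAt H y).open_source.mem_nhds (mem_chart_source H y)] with z hz
    exact (congrArg φ.symm ((chartAt H y).left_inv hz)).symm

/-- A continuous map whose composite with a local diffeomorphism is smooth is smooth. -/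
theorem contMDiff_of_comp_isLocalDiffeomorph {B' : Type*} [NormedAddCommGroup B']
    [NormedSpace ℝ B'] {H' : Type*} [TopologicalSpace H'] {I' : ModelWithCorners ℝ B' H'}
    {N : Type*} [TopologicalSpace N] [ChartedSpace H' N] [ChartedSpace H E]
    {a : E → M} (ha : IsLocalDiffeomorph I I ∞ a) {h : N → E} (hc : Continuous h)
    (hs : ContMDiff I' I ∞ (a ∘ h)) : ContMDiff I' I ∞ h := by
  intro x
  have hx := ha (h x)
  have h1 : ContMDiffAt I I ∞ hx.localInverse (a (h x)) := hx.localInverse_contMDiffAt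
  have h2 : ContMDiffAt I' I ∞ (hx.localInverse ∘ (a ∘ h)) x :=
    ContMDiffAt.comp x h1 (hs x)
  refine h2.congr_of_eventuallyEq ?_
  have h3 := hc.continuousAt.eventually hx.localInverse_eventuallyEq_left
  filter_upwards [h3] with y hy
  exact hy.symm

end Etale

/-! ### Crossed modules -/

/-- A crossed module of Lie groups `∂ : Γ → G` with `Γ` discrete. A smooth map into the
zero-dimensional manifold `Γ` is a locally constant one. -/
structure DiscreteCrossedModule (V : Type w) [NormedAddCommGroup V] [NormedSpace ℝ V]
    (Γ : Type u) [Group Γ] (G : Type v) [TopologicalSpace G] [ChartedSpace V G] [Group G]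
    [LieGroup 𝓘(ℝ, V) ∞ G] where
  /-- the homomorphism `∂` -/
  bd : Γ →* G
  /-- the action `x * γ` of `G` on `Γ` by automorphisms -/
  act : G →* MulAut Γ
  act_smooth : ∀ γ : Γ, IsLocallyConstant fun x : G => act x γ
  equivariance : ∀ (x : G) (γ : Γ), bd (act x γ) = x * bd γ * x⁻¹
  peiffer : ∀ γ γ' : Γ, act (bd γ) γ' = γ * γ' * γ⁻¹

namespace DiscreteCrossedModule

variable {V : Type w} [NormedAddCommGroup V] [NormedSpace ℝ V]
  {Γ : Type u} [Group Γ] {G : Type v} [TopologicalSpace G] [ChartedSpace V G] [Group G]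
  [LieGroup 𝓘(ℝ, V) ∞ G]

/-! ### Maps from manifolds into the stack presented by a crossed module -/

/-- A map from the manifold `M` to the differentiable stack `𝒢 = [G/Γ]` presented by the
translation groupoid `Γ ⋉ G` of the action `γ · x = ∂(γ) x`: a right principal `Γ ⋉ G`-bibundle
`M ← E → G`. Since `Γ` is discrete this is a principal right `Γ`-bundle `a : E → M` (étale over `M`,
hence a manifold with the same model) with a smooth map `b : E → G` that is equivariant for the
right action `x · γ = ∂(γ)⁻¹ x` of `Γ` on `G`. -/
structure StackMap (X : DiscreteCrossedModule V Γ G)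
    {B : Type} [NormedAddCommGroup B] [NormedSpace ℝ B] {H : Type} [TopologicalSpace H]
    (I : ModelWithCorners ℝ B H) (M : Type) [TopologicalSpace M] [ChartedSpace H M] where
  /-- the total space -/
  E : Type u
  [top : TopologicalSpace E]
  [charts : ChartedSpace H E]
  [mfd : IsManifold I ∞ E]
  /-- the bundle projection -/
  a : E → M
  /-- the anchor map -/
  b : E → G
  /-- the right action of `Γ` -/
  act : E → Γ → E
  act_one : ∀ e, act e 1 = e
  act_mul : ∀ e γ γ', act e (γ * γ') = act (act e γ) γ'
  act_smooth : ∀ γ, ContMDiff I I ∞ fun e => act e γ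
  a_etale : IsLocalDiffeomorph I I ∞ a
  a_surj : Function.Surjective a
  a_act : ∀ e γ, a (act e γ) = a e
  principal : ∀ e e', a e = a e' → ∃! γ, e' = act e γ
  b_smooth : ContMDiff I 𝓘(ℝ, V) ∞ b
  b_act : ∀ e γ, b (act e γ) = (X.bd γ)⁻¹ * b e

attribute [instance] StackMap.top StackMap.charts StackMap.mfd

variable {X : DiscreteCrossedModule V Γ G}
  {B : Type} [NormedAddCommGroup B] [NormedSpace ℝ B] {H : Type} [TopologicalSpace H]
  {I : ModelWithCorners ℝ B H} {M : Type} [TopologicalSpace M] [ChartedSpace H M]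
  {B' : Type} [NormedAddCommGroup B'] [NormedSpace ℝ B'] {H' : Type} [TopologicalSpace H']
  {I' : ModelWithCorners ℝ B' H'} {N : Type} [TopologicalSpace N] [ChartedSpace H' N]

/-- For a smooth map `f : N → M`, the map `P : N → 𝒢` is 2-isomorphic to the composite of `f` with
`Q : M → 𝒢`: there is a smooth equivariant bundle map from `P` to `Q` that covers `f` and commutes
with the anchors (equivalently, an isomorphism of `P` with the pullback of `Q` along `f`). -/
def TwoIsoComp (f : N → M) (P : X.StackMap I' N) (Q : X.StackMap I M) : Prop :=
  ∃ Φ : P.E → Q.E, ContMDiff I' I ∞ Φ ∧ (∀ e, Q.a (Φ e) = f (P.a e)) ∧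
    (∀ e γ, Φ (P.act e γ) = Q.act (Φ e) γ) ∧ ∀ e, Q.b (Φ e) = P.b e

/-- The total space of the trivial `Γ`-bundle over `M`, with `Γ` discrete. -/
def TrivialTotal (Γ : Type u) (M : Type) : Type u := M × Γ

instance : TopologicalSpace (TrivialTotal Γ M) :=
  @instTopologicalSpaceProd M Γ _ ⊥

theorem isLocalHomeomorph_trivial_fst {Γ : Type u} {M : Type} [TopologicalSpace M] :
    IsLocalHomeomorph (fun e : TrivialTotal Γ M => e.1) := by
  let : TopologicalSpace Γ := ⊥
  have : DiscreteTopology Γ := ⟨rfl⟩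
  have hopen : IsOpenMap (fun e : TrivialTotal Γ M => e.1) := isOpenMap_fst (X := M) (Y := Γ)
  have hcont : Continuous (fun e : TrivialTotal Γ M => e.1) := continuous_fst (X := M) (Y := Γ)
  refine IsLocalHomeomorph.mk _ fun e => ?_
  have hs : IsOpen {x : TrivialTotal Γ M | x.2 = e.2} :=
    (isOpen_discrete ({e.2} : Set Γ)).preimage (continuous_snd (X := M) (Y := Γ))
  refine ⟨OpenPartialHomeomorph.ofContinuousOpen
    { toFun := fun x => x.1
      invFun := fun m => (m, e.2)
      source := {x : TrivialTotal Γ M | x.2 = e.2}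
      target := Set.univ
      map_source' := fun _ _ => Set.mem_univ _
      map_target' := fun _ _ => rfl
      left_inv' := fun x hx => Prod.ext rfl (Eq.symm hx)
      right_inv' := fun _ _ => rfl } hcont.continuousOn hopen hs, rfl, fun _ _ => rfl⟩

instance : ChartedSpace H (TrivialTotal Γ M) :=
  etaleChartedSpace (fun e : TrivialTotal Γ M => e.1) isLocalHomeomorph_trivial_fst

instance [IsManifold I ∞ M] : IsManifold I ∞ (TrivialTotal Γ M) :=
  etale_isManifold _ isLocalHomeomorph_trivial_fst

/-- The composite of a smooth map `f : M → G` with the atlas `p : G → 𝒢`: the trivial bundle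
`M × Γ` with anchor `(m, γ) ↦ ∂(γ)⁻¹ f(m)`. -/
def ofMap (X : DiscreteCrossedModule V Γ G) [IsManifold I ∞ M] (f : M → G)
    (hf : ContMDiff I 𝓘(ℝ, V) ∞ f) : X.StackMap I M where
  E := TrivialTotal Γ M
  a e := e.1
  b e := (X.bd e.2)⁻¹ * f e.1
  act e γ := (e.1, e.2 * γ)
  act_one e := Prod.ext rfl (mul_one _)
  act_mul e γ γ' := Prod.ext rfl (mul_assoc _ _ _).symm
  act_smooth γ := by
    let : TopologicalSpace Γ := ⊥
    have : DiscreteTopology Γ := ⟨rfl⟩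
    have ha : IsLocalDiffeomorph I I ∞ (fun e : TrivialTotal Γ M => e.1) :=
      etale_isLocalDiffeomorph _ isLocalHomeomorph_trivial_fst
    refine contMDiff_of_comp_isLocalDiffeomorph ha ?_ ha.contMDiff
    have hm : Continuous fun x : Γ => x * γ := continuous_of_discreteTopology
    exact (continuous_fst (X := M) (Y := Γ)).prodMk (hm.comp (continuous_snd (X := M) (Y := Γ)))
  a_etale := etale_isLocalDiffeomorph _ isLocalHomeomorph_trivial_fst
  a_surj m := ⟨(m, 1), rfl⟩
  a_act _ _ := rfl
  principal e e' h := by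
    refine ⟨e.2⁻¹ * e'.2, Prod.ext h.symm (mul_inv_cancel_left _ _).symm, ?_⟩
    intro γ hγ
    rw [hγ]
    exact (inv_mul_cancel_left _ _).symm
  b_smooth := by
    let : TopologicalSpace Γ := ⊥
    have : DiscreteTopology Γ := ⟨rfl⟩
    have ha : IsLocalDiffeomorph I I ∞ (fun e : TrivialTotal Γ M => e.1) :=
      etale_isLocalDiffeomorph _ isLocalHomeomorph_trivial_fst
    intro e
    have h : ContMDiff I 𝓘(ℝ, V) ∞
        (fun x : TrivialTotal Γ M => (X.bd e.2)⁻¹ * f x.1) :=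
      (contMDiff_mul_left (I := 𝓘(ℝ, V)) (n := ∞) (a := (X.bd e.2)⁻¹)).comp
        (hf.comp ha.contMDiff)
    refine (h e).congr_of_eventuallyEq ?_
    have hs : IsOpen {x : TrivialTotal Γ M | x.2 = e.2} :=
      (isOpen_discrete ({e.2} : Set Γ)).preimage (continuous_snd (X := M) (Y := Γ))
    filter_upwards [hs.mem_nhds rfl] with x hx
    exact congrArg (fun γ => (X.bd γ)⁻¹ * f x.1) hx
  b_act e γ := by
    simp only [map_mul, mul_inv_rev, mul_assoc]

/-- The constant map `M → ⋆ → 𝒢` at the unit of `𝒢`. -/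
def unitMap (X : DiscreteCrossedModule V Γ G) (I : ModelWithCorners ℝ B H) (M : Type)
    [TopologicalSpace M] [ChartedSpace H M] [IsManifold I ∞ M] : X.StackMap I M :=
  X.ofMap (fun _ => 1) contMDiff_const

/-! ### The fundamental group -/

/-- The one-point manifold. -/
abbrev Pt : Type := EuclideanSpace ℝ (Fin 0)

/-- A representative loop: a map `S¹ → 𝒢` whose restriction to the base point `1 ∈ S¹` is
2-isomorphic to the unit of `𝒢`. -/
def Loop (X : DiscreteCrossedModule V Γ G) : Type _ :=
  {P : X.StackMap (𝓡 1) Circle //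
    TwoIsoComp (fun _ : Pt => (1 : Circle)) (X.unitMap (𝓡 0) Pt) P}

/-- Homotopy of loops relative to the base point. -/
def Homotopic (ℓ₀ ℓ₁ : X.Loop) : Prop :=
  ∃ F : X.StackMap ((𝓡 1).prod 𝓘(ℝ, ℝ)) (Circle × ℝ),
    TwoIsoComp (fun s : ℝ => ((1 : Circle), s)) (X.unitMap 𝓘(ℝ, ℝ) ℝ) F ∧
    TwoIsoComp (fun z : Circle => (z, (0 : ℝ))) ℓ₀.1 F ∧
    TwoIsoComp (fun z : Circle => (z, (1 : ℝ))) ℓ₁.1 F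

/-- The (smooth) first homotopy set of `𝒢` at the unit. -/
def PiOne (X : DiscreteCrossedModule V Γ G) : Type _ :=
  Quot (Homotopic (X := X))

/-- The homotopy class of a loop. -/
def Loop.toPiOne (ℓ : X.Loop) : X.PiOne := Quot.mk _ ℓ

/-- The loop is constant near the base point. -/
def Loop.ConstNearBase (ℓ : X.Loop) : Prop :=
  ∃ U : TopologicalSpace.Opens Circle, (1 : Circle) ∈ U ∧
    TwoIsoComp (fun z : U => (z : Circle)) (X.unitMap (𝓡 1) U) ℓ.1

/-- An isomorphism, over the subset `S` of the circle, of `P` with the composite of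
`z ↦ z ^ 2` and `Q`. -/
def IsSquareIsoOn (S : Set Circle) (P Q : X.StackMap (𝓡 1) Circle) (Φ : P.E → Q.E) : Prop :=
  ContMDiffOn (𝓡 1) (𝓡 1) ∞ Φ (P.a ⁻¹' S) ∧ ∀ e, P.a e ∈ S →
    Q.a (Φ e) = P.a e ^ 2 ∧ (∀ γ, Φ (P.act e γ) = Q.act (Φ e) γ) ∧ Q.b (Φ e) = P.b e

/-- `ℓ` is a concatenation of `ℓ₀` (run through first, on the upper half circle) and `ℓ₁` (on the
lower half circle): the restrictions of `ℓ` to the two half circles are identified with `ℓ₀` and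
`ℓ₁`, each run through at double speed, and at the two points where the half circles meet
the identifications agree through fixed isomorphisms `e₀`, `e₁` of the
base points of `ℓ₀`, `ℓ₁` with the unit (an isomorphism of the fibre at `z` with the unit of `𝒢` is
a point of the fibre with anchor `1`). -/
def IsConcat (ℓ₀ ℓ₁ ℓ : X.Loop) : Prop :=
  ∃ (Φ₀ : ℓ.1.E → ℓ₀.1.E) (Φ₁ : ℓ.1.E → ℓ₁.1.E),
    IsSquareIsoOn {z | 0 ≤ (z : ℂ).im} ℓ.1 ℓ₀.1 Φ₀ ∧
    IsSquareIsoOn {z | (z : ℂ).im ≤ 0} ℓ.1 ℓ₁.1 Φ₁ ∧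
    ∃ (e₀ : ℓ₀.1.E) (e₁ : ℓ₁.1.E) (e e' : ℓ.1.E),
      ℓ₀.1.a e₀ = 1 ∧ ℓ₀.1.b e₀ = 1 ∧ ℓ₁.1.a e₁ = 1 ∧ ℓ₁.1.b e₁ = 1 ∧
      (ℓ.1.a e : ℂ) = 1 ∧ (ℓ.1.a e' : ℂ) = -1 ∧
      Φ₀ e = e₀ ∧ Φ₁ e = e₁ ∧ Φ₀ e' = e₀ ∧ Φ₁ e' = e₁

/-- A lift of the loop `ℓ` through the unit of `G`: a smooth `lam : ℝ → E = S¹ ×_𝒢 G` over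
`t ↦ exp (2πit)` whose projection to `G` starts at the unit. -/
def IsLift (ℓ : X.Loop) (lam : ℝ → ℓ.1.E) : Prop :=
  ContMDiff 𝓘(ℝ, ℝ) (𝓡 1) ∞ lam ∧
    (∀ t, ℓ.1.a (lam t) = Circle.exp (2 * Real.pi * t)) ∧ ℓ.1.b (lam 0) = 1

end DiscreteCrossedModule

end

set_option linter.unusedSectionVars false

noncomputable section

open Topology Filter

namespace DiscreteCrossedModule

variable {V : Type w} [NormedAddCommGroup V] [NormedSpace ℝ V]
  {Γ : Type u} [Group Γ] {G : Type v} [TopologicalSpace G] [ChartedSpace V G] [Group G]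
  [LieGroup 𝓘(ℝ, V) ∞ G]

/-! A loop becomes a pair of elementary data once it is pulled back to `ℝ`. The bundle `E` over the
circle is a covering, so `t ↦ exp (2πit)` lifts to `lam : ℝ → E`, starting at a point with anchor
`1`. If `lam 1 = lam 0 · γ`, then `f = b ∘ lam` satisfies `f 0 = 1` and `f (t + 1) = ∂(γ)⁻¹ f t`;
call this a twisted path. Conversely, a twisted path descends along the universal cover, with
cocycle `γ ^ (t - s)`, to a loop with `Γ`-difference `γ` (`exists_stackMap_of_cocycle`,
`exists_loop`).

The action of `G` on `Γ` is locally constant and `G` is connected, so it is trivial, and the Peiffer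
identity makes `Γ` commutative. Hence `γ` does not depend on the lift. It is a homotopy invariant
because a homotopy also lifts, to `ℝ × ℝ`, and its two edges over the base point differ by a
constant element of `Γ` (`Homotopic.diff_eq`).

Surjectivity of `∂₁` needs a twisted path for every `γ`, that is, a smooth path from `1` to
`∂(γ)⁻¹`. Injectivity needs a smooth homotopy between any two twisted paths with the same factor
(`IsTwistedPath.homotopic`), which then descends to `S¹ × ℝ`. Continuous paths and homotopies exist
because `G` is simply connected. They are smoothed with the group law and a smooth contraction of a
neighbourhood of `1`: close twisted paths are homotopic, and a continuous homotopy is a connected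
family of paths, each close to a smooth twisted one.

A concatenation has as its `Γ`-difference the product of the two (`IsConcat.diff_eq`). So the group
structure transported from `Γ` along the bijection is the one induced by concatenation. -/

/-- A connected group acts trivially on a discrete one, so that the Peiffer identity makes `Γ`
commutative. -/
theorem mul_comm_of_preconnected [PreconnectedSpace G] (X : DiscreteCrossedModule V Γ G)
    (γ γ' : Γ) : γ * γ' = γ' * γ := by
  have h1 : X.act (X.bd γ) γ' = X.act 1 γ' :=
    (X.act_smooth γ').apply_eq_of_isPreconnected isPreconnected_univ (Set.mem_univ _)
      (Set.mem_univ _)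
  rw [X.peiffer, map_one, MulAut.one_apply] at h1
  exact mul_inv_eq_iff_eq_mul.mp h1

/-! ### Bundles with discrete structure group as coverings -/

namespace StackMap

variable {X : DiscreteCrossedModule V Γ G}
  {B : Type} [NormedAddCommGroup B] [NormedSpace ℝ B] {H : Type} [TopologicalSpace H]
  {I : ModelWithCorners ℝ B H} {M : Type} [TopologicalSpace M] [ChartedSpace H M]
  (P : X.StackMap I M)

theorem isLocalHomeomorph_a : IsLocalHomeomorph P.a := P.a_etale.isLocalHomeomorph

theorem continuous_act (γ : Γ) : Continuous fun e => P.act e γ := (P.act_smooth γ).continuous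

theorem act_act_inv (e : P.E) (γ : Γ) : P.act (P.act e γ) γ⁻¹ = e := by
  rw [← P.act_mul, mul_inv_cancel, P.act_one]

theorem act_injective (e : P.E) : Function.Injective (P.act e) := fun γ _ h =>
  (P.principal e (P.act e γ) (P.a_act e γ).symm).unique rfl h

theorem exists_act {e e' : P.E} (h : P.a e = P.a e') : ∃ γ, e' = P.act e γ :=
  (P.principal e e' h).exists

/-- A principal bundle with discrete structure group is a covering. -/
theorem isCoveringMap_a : IsCoveringMap P.a := by
  -- The right action is a left action of the opposite group, the form that quotient coverings take.
  let : MulAction Γᵐᵒᵖ P.E :=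
    { smul := fun γ e => P.act e γ.unop
      one_smul := fun e => P.act_one e
      mul_smul := fun γ γ' e => P.act_mul e γ'.unop γ.unop }
  have hsmul : ∀ (γ : Γᵐᵒᵖ) (e : P.E), γ • e = P.act e γ.unop := fun _ _ => rfl
  have : IsQuotientCoveringMap P.a Γᵐᵒᵖ := by
    refine
      { toIsQuotientMap := P.isLocalHomeomorph_a.isOpenMap.isQuotientMap
          P.isLocalHomeomorph_a.continuous P.a_surj
        continuous_const_smul := fun γ => P.continuous_act γ.unop
        apply_eq_iff_mem_orbit := ?_
        disjoint := ?_ }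
    · intro e e'
      constructor
      · intro h
        obtain ⟨γ, hγ⟩ := P.exists_act h.symm
        exact ⟨MulOpposite.op γ, hγ.symm⟩
      · rintro ⟨γ, rfl⟩
        exact P.a_act e' γ.unop
    · intro e
      -- Translation preserves fibres and `a` is injective on `U`, so a translation that returns a
      -- point of `U` to `U` fixes that point; the action is free.
      obtain ⟨U, hU, heU, hinj⟩ := P.isLocalHomeomorph_a.isLocallyInjective e
      refine ⟨U, hU.mem_nhds heU, fun γ => ?_⟩
      rintro ⟨_, ⟨x, hx, rfl⟩, hx'⟩
      have h : P.act x γ.unop = x := hinj hx' hx (P.a_act x _)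
      exact MulOpposite.unop_injective (P.act_injective x (h.trans (P.act_one x).symm))
  exact this.isCoveringMap

theorem lift_unique {A : Type*} [TopologicalSpace A] [PreconnectedSpace A] {g₁ g₂ : A → P.E}
    (h₁ : Continuous g₁) (h₂ : Continuous g₂) (h : ∀ x, P.a (g₁ x) = P.a (g₂ x)) (x₀ : A)
    (h₀ : g₁ x₀ = g₂ x₀) (x : A) : g₁ x = g₂ x :=
  congrFun (P.isCoveringMap_a.eq_of_comp_eq h₁ h₂ (funext h) x₀ h₀) x

/-- `a` is injective near `e₀`. This is the local form of uniqueness of lifts, without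
connectedness. -/
theorem lift_eventuallyEq {A : Type*} [TopologicalSpace A] {g₁ g₂ : A → P.E} {e₀ : P.E}
    {l : Filter A} (h₁ : Tendsto g₁ l (𝓝 e₀)) (h₂ : Tendsto g₂ l (𝓝 e₀))
    (h : ∀ᶠ x in l, P.a (g₁ x) = P.a (g₂ x)) : g₁ =ᶠ[l] g₂ := by
  obtain ⟨U, hU, heU, hinj⟩ := P.isLocalHomeomorph_a.isLocallyInjective e₀
  filter_upwards [h₁ (hU.mem_nhds heU), h₂ (hU.mem_nhds heU), h] with x h1 h2 h3
  exact hinj h1 h2 h3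

variable {B' : Type} [NormedAddCommGroup B'] [NormedSpace ℝ B'] {H' : Type} [TopologicalSpace H']
  {I' : ModelWithCorners ℝ B' H'} {N : Type} [TopologicalSpace N] [ChartedSpace H' N]

/-- Smooth maps from simply connected manifolds lift to the total space. -/
theorem exists_lift [SimplyConnectedSpace N] [LocallyPathConnectedSpace N] {g : N → M}
    (hg : ContMDiff I' I ∞ g) (n₀ : N) (e₀ : P.E) (h₀ : P.a e₀ = g n₀) :
    ∃ lam : N → P.E, ContMDiff I' I ∞ lam ∧ (∀ n, P.a (lam n) = g n) ∧ lam n₀ = e₀ := by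
  obtain ⟨F, ⟨hF0, hF⟩, -⟩ := P.isCoveringMap_a.existsUnique_continuousMap_lifts
    ⟨g, hg.continuous⟩ n₀ e₀ h₀
  have hF' : P.a ∘ F = g := hF
  exact ⟨F, contMDiff_of_comp_isLocalDiffeomorph P.a_etale F.continuous (by rwa [hF']),
    congrFun hF', hF0⟩

end StackMap

/-! ### Étale covers -/

/-- A smooth surjective local homeomorphism with smooth local inverses. -/
structure IsEtaleCover {B : Type} [NormedAddCommGroup B] [NormedSpace ℝ B] {H : Type}
    [TopologicalSpace H] (I : ModelWithCorners ℝ B H) {M : Type} [TopologicalSpace M]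
    [ChartedSpace H M] {B' : Type} [NormedAddCommGroup B'] [NormedSpace ℝ B'] {H' : Type}
    [TopologicalSpace H'] (I' : ModelWithCorners ℝ B' H') {N : Type} [TopologicalSpace N]
    [ChartedSpace H' N] (p : N → M) : Prop where
  surjective : Function.Surjective p
  smooth : ContMDiff I' I ∞ p
  isLocalHomeomorph : IsLocalHomeomorph p
  exists_section : ∀ n, ∃ s : M → N, ContMDiffAt I I' ∞ s (p n) ∧ s (p n) = n ∧
    ∀ᶠ m in 𝓝 (p n), p (s m) = m

section EtaleCover

variable {B : Type} [NormedAddCommGroup B] [NormedSpace ℝ B] {H : Type} [TopologicalSpace H]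
  {I : ModelWithCorners ℝ B H} {M : Type} [TopologicalSpace M] [ChartedSpace H M]
  {B' : Type} [NormedAddCommGroup B'] [NormedSpace ℝ B'] {H' : Type} [TopologicalSpace H']
  {I' : ModelWithCorners ℝ B' H'} {N : Type} [TopologicalSpace N] [ChartedSpace H' N]

theorem isEtaleCover_id : IsEtaleCover I I (fun m : M => m) where
  surjective m := ⟨m, rfl⟩
  smooth := contMDiff_id
  isLocalHomeomorph := (Homeomorph.refl M).isLocalHomeomorph
  exists_section _ := ⟨fun m => m, contMDiffAt_id, rfl, Eventually.of_forall fun _ => rfl⟩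

/-- The universal cover `t ↦ exp (2πit)` of the circle. -/
def expCircle (t : ℝ) : Circle := Circle.exp (2 * Real.pi * t)

theorem contMDiff_expCircle : ContMDiff 𝓘(ℝ, ℝ) (𝓡 1) ∞ expCircle :=
  contMDiff_circleExp.comp (contDiff_const.mul contDiff_id).contMDiff

theorem expCircle_add (s t : ℝ) : expCircle (s + t) = expCircle s * expCircle t := by
  rw [expCircle, mul_add, Circle.exp_add]; rfl

theorem expCircle_intCast (k : ℤ) : expCircle k = 1 := by
  rw [expCircle, mul_comm, Circle.exp_int_mul_two_pi]

theorem expCircle_zero : expCircle 0 = 1 := by simpa using expCircle_intCast 0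

theorem expCircle_one : expCircle 1 = 1 := by simpa using expCircle_intCast 1

theorem expCircle_add_one (t : ℝ) : expCircle (t + 1) = expCircle t := by
  rw [expCircle_add, expCircle_one, mul_one]

theorem expCircle_eq_iff {s t : ℝ} : expCircle s = expCircle t ↔ ∃ k : ℤ, t = s + k := by
  constructor
  · intro h
    obtain ⟨k, hk⟩ := Circle.exp_eq_exp.mp h.symm
    refine ⟨k, ?_⟩
    have : 2 * Real.pi ≠ 0 := by positivity
    apply mul_left_cancel₀ this
    rw [hk]; ring
  · rintro ⟨k, rfl⟩
    rw [expCircle_add, expCircle_intCast, mul_one]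

theorem expCircle_sq (t : ℝ) : expCircle t ^ 2 = expCircle (2 * t) := by
  rw [two_mul, expCircle_add, sq]

theorem expCircle_surjective : Function.Surjective expCircle := by
  intro z
  refine ⟨Complex.arg z / (2 * Real.pi), ?_⟩
  rw [expCircle, mul_div_cancel₀ _ (by positivity), Circle.exp_arg]

theorem isLocalHomeomorph_expCircle : IsLocalHomeomorph expCircle :=
  isLocalHomeomorph_circleExp.comp
    (Homeomorph.mulLeft₀ (2 * Real.pi) (by positivity)).isLocalHomeomorph

attribute [local instance] finrank_real_complex_fact'

theorem contMDiff_circle_coe : ContMDiff (𝓡 1) 𝓘(ℝ, ℂ) ∞ (fun z : Circle => (z : ℂ)) :=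
  contMDiff_coe_sphere

theorem isEtaleCover_expCircle : IsEtaleCover (𝓡 1) 𝓘(ℝ, ℝ) expCircle where
  surjective := expCircle_surjective
  smooth := contMDiff_expCircle
  isLocalHomeomorph := isLocalHomeomorph_expCircle
  exists_section t := by
    -- The section through `t` rotates `exp (2πit)` to `1` and uses the principal logarithm, which
    -- is smooth there.
    refine ⟨fun z => t + (Complex.log ((z * (expCircle t)⁻¹ : Circle) : ℂ)).im / (2 * Real.pi),
      ?_, ?_, Eventually.of_forall fun z => ?_⟩
    · have h1 : ContMDiffAt (𝓡 1) 𝓘(ℝ, ℂ) ∞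
          (fun z : Circle => ((z * (expCircle t)⁻¹ : Circle) : ℂ)) (expCircle t) := by
        have : ContMDiff (𝓡 1) 𝓘(ℝ, ℂ) ∞
            (fun z : Circle => (z : ℂ) * (((expCircle t)⁻¹ : Circle) : ℂ)) :=
          (contDiff_id.mul contDiff_const).contMDiff.comp contMDiff_circle_coe
        simpa using this.contMDiffAt
      have h2 : ContDiffAt ℝ ∞ (fun w : ℂ => t + (Complex.log w).im / (2 * Real.pi)) 1 := by
        have : ContDiffAt ℝ ∞ Complex.log 1 :=
          (Complex.contDiffAt_log Complex.one_mem_slitPlane).restrict_scalars ℝ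
        exact contDiffAt_const.add ((Complex.imCLM.contDiff.contDiffAt.comp _ this).div_const _)
      have h3 : ((expCircle t * (expCircle t)⁻¹ : Circle) : ℂ) = 1 := by
        rw [mul_inv_cancel]; rfl
      rw [← h3] at h2
      exact ContMDiffAt.comp (g := fun w : ℂ => t + (Complex.log w).im / (2 * Real.pi))
        (expCircle t) h2.contMDiffAt h1
    · simp
    · rw [expCircle_add]
      have : expCircle ((Complex.log ((z * (expCircle t)⁻¹ : Circle) : ℂ)).im / (2 * Real.pi))
          = z * (expCircle t)⁻¹ := by
        rw [expCircle, mul_div_cancel₀ _ (by positivity), Complex.log_im, Circle.exp_arg]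
      rw [this, mul_comm, inv_mul_cancel_right]

/-- Homotopies live on `Circle × ℝ`; this supplies the cover of it by `ℝ × ℝ`. -/
theorem IsEtaleCover.prodMap_id {p : N → M} (hp : IsEtaleCover I I' p) :
    IsEtaleCover (I.prod 𝓘(ℝ, ℝ)) (I'.prod 𝓘(ℝ, ℝ)) (Prod.map p (fun s : ℝ => s)) where
  surjective := hp.surjective.prodMap fun s => ⟨s, rfl⟩
  smooth := hp.smooth.prodMap contMDiff_id
  isLocalHomeomorph := by
    refine IsLocalHomeomorph.mk _ fun x => ?_
    obtain ⟨φ, hx, hφ⟩ := hp.isLocalHomeomorph x.1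
    exact ⟨φ.prod (OpenPartialHomeomorph.refl ℝ), ⟨hx, trivial⟩, fun y _ => by
      rw [hφ]; rfl⟩
  exists_section x := by
    obtain ⟨s, hs, hsn, hps⟩ := hp.exists_section x.1
    refine ⟨Prod.map s (fun r : ℝ => r), hs.prodMap contMDiffAt_id, Prod.ext hsn rfl, ?_⟩
    filter_upwards [continuous_fst.continuousAt.eventually hps] with y hy
    exact Prod.ext hy rfl

/-- A local section of an étale cover is also a left inverse. -/
theorem IsEtaleCover.eventually_section_apply {p : N → M} (hp : IsEtaleCover I I' p) {n : N}
    {s : M → N} (hs : ContinuousAt s (p n)) (hsn : s (p n) = n)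
    (hps : ∀ᶠ m in 𝓝 (p n), p (s m) = m) : ∀ᶠ n' in 𝓝 n, s (p n') = n' := by
  obtain ⟨U, hU, hnU, hinj⟩ := hp.isLocalHomeomorph.isLocallyInjective n
  have hpc := hp.smooth.continuous.continuousAt (x := n)
  have h1 : Tendsto (fun n' => s (p n')) (𝓝 n) (𝓝 n) := by
    have := hs.tendsto.comp hpc.tendsto
    rwa [hsn] at this
  filter_upwards [h1 (hU.mem_nhds hnU), hU.mem_nhds hnU, hpc.eventually hps] with n' h2 h3 h4
  exact hinj h2 h3 h4

end EtaleCover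

end DiscreteCrossedModule

end

noncomputable section

open Topology Filter

namespace DiscreteCrossedModule

variable {V : Type w} [NormedAddCommGroup V] [NormedSpace ℝ V]
  {Γ : Type u} [Group Γ] {G : Type v} [TopologicalSpace G] [ChartedSpace V G] [Group G]
  [LieGroup 𝓘(ℝ, V) ∞ G]

/-- A point of the total space of the trivial bundle. -/
def trivialPoint {M : Type} (m : M) (γ : Γ) : TrivialTotal Γ M := (m, γ)

/-! ### Bundle maps determined by their values on a lift -/

section BundleMap

variable {X : DiscreteCrossedModule V Γ G}
  {B : Type} [NormedAddCommGroup B] [NormedSpace ℝ B] {H : Type} [TopologicalSpace H]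
  {I : ModelWithCorners ℝ B H} {M : Type} [TopologicalSpace M] [ChartedSpace H M]
  {B' : Type} [NormedAddCommGroup B'] [NormedSpace ℝ B'] {H' : Type} [TopologicalSpace H']
  {I' : ModelWithCorners ℝ B' H'} {N : Type} [TopologicalSpace N] [ChartedSpace H' N]
  {C : Type} [NormedAddCommGroup C] [NormedSpace ℝ C] {K : Type} [TopologicalSpace K]
  {J : ModelWithCorners ℝ C K} {L : Type} [TopologicalSpace L] [ChartedSpace K L]

/-- Near a point of the total space, every point is a translate of the lift `lam` of an étale
cover, evaluated at a local section of that cover. -/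
theorem StackMap.eventually_eq_act (P : X.StackMap I M) {p : N → M} {lam : N → P.E}
    (hlam : Continuous lam) (hlama : ∀ n, P.a (lam n) = p n) {s : M → N} {n : N} (δ : Γ)
    (hs : ContinuousAt s (p n)) (hsn : s (p n) = n) (hps : ∀ᶠ m in 𝓝 (p n), p (s m) = m) :
    ∀ᶠ e in 𝓝 (P.act (lam n) δ), e = P.act (lam (s (P.a e))) δ := by
  have hae : P.a (P.act (lam n) δ) = p n := (P.a_act _ _).trans (hlama n)
  have hac : Tendsto P.a (𝓝 (P.act (lam n) δ)) (𝓝 (p n)) := by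
    simpa only [hae] using P.isLocalHomeomorph_a.continuous.tendsto (P.act (lam n) δ)
  refine P.lift_eventuallyEq tendsto_id (e₀ := P.act (lam n) δ) ?_ ?_
  · have h1 : Tendsto s (𝓝 (p n)) (𝓝 n) := by simpa only [hsn] using hs.tendsto
    exact (((P.continuous_act δ).comp hlam).tendsto n).comp (h1.comp hac)
  · filter_upwards [hac hps] with e he
    rw [P.a_act, hlama]
    exact he.symm

/-- Construction of bundle maps: over the image of `T` under an étale cover with lift `lam`, an
equivariant map is given by its values `mu` on the lift. -/
theorem exists_bundleMap (P : X.StackMap I M) (Q : X.StackMap J L) {f : M → L} {p : N → M}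
    (hp : IsEtaleCover I I' p) {lam : N → P.E} (hlam : Continuous lam)
    (hlama : ∀ n, P.a (lam n) = p n) {mu : N → Q.E} (hmu : ContMDiff I' J ∞ mu) {T : Set N}
    (hT : ∀ t ∈ T, ∀ᶠ n in 𝓝 t, p n ∈ p '' T → n ∈ T)
    (ha : ∀ t ∈ T, Q.a (mu t) = f (p t)) (hb : ∀ t ∈ T, Q.b (mu t) = P.b (lam t))
    (hc : ∀ t ∈ T, ∀ t' ∈ T, ∀ γ, lam t' = P.act (lam t) γ → mu t' = Q.act (mu t) γ) :
    ∃ Φ : P.E → Q.E, ContMDiffOn I J ∞ Φ (P.a ⁻¹' (p '' T)) ∧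
      (∀ e, P.a e ∈ p '' T → Q.a (Φ e) = f (P.a e) ∧
        (∀ γ, Φ (P.act e γ) = Q.act (Φ e) γ) ∧ Q.b (Φ e) = P.b e) ∧
      ∀ t ∈ T, Φ (lam t) = mu t := by
  -- Equivariance forces the value at a translate of `lam t`; `hc` says that different ways of
  -- writing the same point agree.
  have key : ∀ e, ∃ x : Q.E, ∀ t ∈ T, ∀ δ, e = P.act (lam t) δ → x = Q.act (mu t) δ := by
    intro e
    by_cases h : ∃ t ∈ T, ∃ δ, e = P.act (lam t) δ
    · obtain ⟨t, ht, δ, rfl⟩ := h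
      refine ⟨Q.act (mu t) δ, fun t' ht' δ' h => ?_⟩
      have h1 : lam t' = P.act (lam t) (δ * δ'⁻¹) := by
        rw [P.act_mul, h, P.act_act_inv]
      rw [hc t ht t' ht' _ h1, ← Q.act_mul, inv_mul_cancel_right]
    -- Away from the preimage of `p '' T` any value will do; `mu n` only shows that `Q.E` is
    -- inhabited.
    · obtain ⟨n, -⟩ := hp.surjective (P.a e)
      exact ⟨mu n, fun t ht δ hδ => absurd ⟨t, ht, δ, hδ⟩ h⟩
  choose Φ hΦ using key
  have hrep : ∀ e, P.a e ∈ p '' T → ∃ t ∈ T, ∃ δ, e = P.act (lam t) δ := by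
    rintro e ⟨t, ht, hte⟩
    obtain ⟨δ, hδ⟩ := P.exists_act ((hlama t).trans hte)
    exact ⟨t, ht, δ, hδ⟩
  refine ⟨Φ, fun e he => ?_, fun e he => ?_, fun t ht => ?_⟩
  · obtain ⟨t, ht, δ, rfl⟩ := hrep e he
    obtain ⟨s, hs, hsn, hps⟩ := hp.exists_section t
    have hae : P.a (P.act (lam t) δ) = p t := (P.a_act _ _).trans (hlama t)
    have hs' : ContMDiffAt I J ∞ (fun m => Q.act (mu (s m)) δ) (p t) := by
      have := (((Q.act_smooth δ).comp hmu) (s (p t))).comp (p t) hs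
      exact this
    rw [← hae] at hs'
    have h1 : ContMDiffAt I J ∞ (fun e => Q.act (mu (s (P.a e))) δ) (P.act (lam t) δ) :=
      ContMDiffAt.comp (g := fun m => Q.act (mu (s m)) δ) _ hs' (P.a_etale.contMDiff _)
    have hac : Tendsto P.a (𝓝 (P.act (lam t) δ)) (𝓝 (p t)) := by
      simpa only [hae] using P.isLocalHomeomorph_a.continuous.tendsto (P.act (lam t) δ)
    have hst : Tendsto s (𝓝 (p t)) (𝓝 t) := by
      simpa only [hsn] using hs.continuousAt.tendsto
    -- `T` need not be open: `hT` keeps the local section inside `T` over `p '' T`, so the smooth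
    -- formula holds on a relative neighbourhood, which is what smoothness on a set requires.
    have h2 : ∀ᶠ e in 𝓝 (P.act (lam t) δ), P.a e ∈ p '' T →
        Φ e = Q.act (mu (s (P.a e))) δ := by
      filter_upwards [P.eventually_eq_act hlam hlama δ hs.continuousAt hsn hps,
        (hst.comp hac) (hT t ht), hac hps] with e h3 h4 h5 h6
      have h5' : p (s (P.a e)) = P.a e := h5
      refine hΦ e _ (h4 ?_) δ h3
      rw [Function.comp_apply, h5']
      exact h6
    refine h1.contMDiffWithinAt.congr_of_eventuallyEq ?_ ?_
    · exact eventually_nhdsWithin_iff.mpr h2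
    · exact h2.self_of_nhds he
  · obtain ⟨t, ht, δ, rfl⟩ := hrep e he
    have h1 := hΦ _ t ht δ rfl
    refine ⟨?_, fun γ => ?_, ?_⟩
    · rw [h1, Q.a_act, P.a_act, hlama, ha t ht]
    · rw [h1, hΦ _ t ht (δ * γ) (P.act_mul _ _ _).symm, Q.act_mul]
    · rw [h1, Q.b_act, P.b_act, hb t ht]
  · have := hΦ (lam t) t ht 1 (P.act_one _).symm
    rwa [Q.act_one] at this

theorem twoIsoComp_of_lift (P : X.StackMap I M) (Q : X.StackMap J L) {f : M → L} {p : N → M}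
    (hp : IsEtaleCover I I' p) {lam : N → P.E} (hlam : Continuous lam)
    (hlama : ∀ n, P.a (lam n) = p n) {mu : N → Q.E} (hmu : ContMDiff I' J ∞ mu)
    (ha : ∀ t, Q.a (mu t) = f (p t)) (hb : ∀ t, Q.b (mu t) = P.b (lam t))
    (hc : ∀ t t' γ, lam t' = P.act (lam t) γ → mu t' = Q.act (mu t) γ) :
    TwoIsoComp f P Q := by
  obtain ⟨Φ, h1, h2, -⟩ := exists_bundleMap P Q hp hlam hlama hmu (T := Set.univ) (f := f)
    (fun _ _ => Eventually.of_forall fun _ _ => trivial) (fun t _ => ha t) (fun t _ => hb t)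
    (fun t _ t' _ => hc t t')
  rw [Set.image_univ, hp.surjective.range_eq, Set.preimage_univ, contMDiffOn_univ] at h1
  have h3 : ∀ e, P.a e ∈ p '' Set.univ := fun e => by
    rw [Set.image_univ, hp.surjective.range_eq]; trivial
  exact ⟨Φ, h1, fun e => (h2 e (h3 e)).1, fun e => (h2 e (h3 e)).2.1, fun e => (h2 e (h3 e)).2.2⟩

theorem isLocalDiffeomorph_trivial_fst [IsManifold I ∞ M] :
    IsLocalDiffeomorph I I ∞ (fun e : TrivialTotal Γ M => e.1) :=
  etale_isLocalDiffeomorph _ isLocalHomeomorph_trivial_fst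

theorem contMDiff_trivial_section [IsManifold I ∞ M] (γ : Γ) :
    ContMDiff I I ∞ (fun m : M => trivialPoint m γ) := by
  let : TopologicalSpace Γ := ⊥
  refine contMDiff_of_comp_isLocalDiffeomorph isLocalDiffeomorph_trivial_fst ?_ contMDiff_id
  exact (continuous_id (X := M)).prodMk continuous_const

/-- A map is trivial along `f` if and only if it has a section along `f` with constant anchor. -/
theorem twoIsoComp_unitMap_iff [IsManifold I ∞ M] {f : M → L} {Q : X.StackMap J L} :
    TwoIsoComp f (X.unitMap I M) Q ↔
      ∃ σ : M → Q.E, ContMDiff I J ∞ σ ∧ (∀ m, Q.a (σ m) = f m) ∧ ∀ m, Q.b (σ m) = 1 := by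
  constructor
  · rintro ⟨Φ, h1, h2, -, h4⟩
    refine ⟨fun m => Φ (trivialPoint m (1 : Γ) : TrivialTotal Γ M),
      h1.comp (contMDiff_trivial_section 1), fun m => h2 _, fun m => ?_⟩
    refine (h4 _).trans ?_
    change (X.bd 1)⁻¹ * 1 = 1
    rw [map_one, inv_one, one_mul]
  · rintro ⟨σ, h1, h2, h3⟩
    refine twoIsoComp_of_lift (X.unitMap I M) Q (isEtaleCover_id (I := I))
      (lam := fun m => trivialPoint m (1 : Γ))
      (contMDiff_trivial_section (I := I) (1 : Γ)).continuous
      (fun _ => rfl) h1 h2 (fun m => ?_) (fun m m' γ h => ?_)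
    · rw [h3]
      change _ = (X.bd 1)⁻¹ * 1
      rw [map_one, inv_one, one_mul]
    · have h' : trivialPoint m' (1 : Γ) = trivialPoint m (1 * γ) := h
      have h5 := congrArg Prod.fst h'
      have h6 := congrArg Prod.snd h'
      simp only [trivialPoint, one_mul] at h5 h6
      subst h5 h6
      rw [Q.act_one]

end BundleMap

/-! ### Descent -/

section Descent

variable {B : Type} [NormedAddCommGroup B] [NormedSpace ℝ B] {H : Type} [TopologicalSpace H]
  {I : ModelWithCorners ℝ B H} {M : Type} [TopologicalSpace M] [ChartedSpace H M]
  {B' : Type} [NormedAddCommGroup B'] [NormedSpace ℝ B'] {H' : Type} [TopologicalSpace H']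
  {I' : ModelWithCorners ℝ B' H'} {N : Type} [TopologicalSpace N] [ChartedSpace H' N]

/-- A locally constant cocycle on the fibre product of `p : N → M` with itself. -/
structure IsCocycle (p : N → M) (c : N → N → Γ) : Prop where
  mul : ∀ n n' n'', p n = p n' → p n' = p n'' → c n n' * c n' n'' = c n n''
  locallyConstant : ∀ n n', p n = p n' →
    ∀ᶠ x in 𝓝 n ×ˢ 𝓝 n', p x.1 = p x.2 → c x.1 x.2 = c n n'

variable {p : N → M} {c : N → N → Γ}

theorem IsCocycle.self (hc : IsCocycle p c) (n : N) : c n n = 1 :=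
  mul_eq_left.mp (hc.mul n n n rfl rfl)

theorem IsCocycle.mul_symm (hc : IsCocycle p c) {n n' : N} (h : p n = p n') :
    c n n' * c n' n = 1 := by
  rw [hc.mul n n' n h h.symm, hc.self]

/-- The equivalence relation on `N × Γ` defined by a cocycle. -/
def IsCocycle.setoid (hc : IsCocycle p c) : Setoid (TrivialTotal Γ N) where
  r x y := p x.1 = p y.1 ∧ x.2 = c x.1 y.1 * y.2
  iseqv :=
    { refl := fun x => ⟨rfl, by rw [hc.self, one_mul]⟩
      symm := fun {x y} h => ⟨h.1.symm, by
        rw [h.2, ← mul_assoc, hc.mul_symm h.1.symm, one_mul]⟩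
      trans := fun {x y z} h h' => ⟨h.1.trans h'.1, by
        rw [h.2, h'.2, ← mul_assoc, hc.mul _ _ _ h.1 h'.1]⟩ }

/-- The total space of the bundle glued from the trivial bundle along a cocycle. -/
def IsCocycle.Total (hc : IsCocycle p c) : Type u := Quotient hc.setoid

instance (hc : IsCocycle p c) : TopologicalSpace hc.Total :=
  inferInstanceAs (TopologicalSpace (Quotient hc.setoid))

namespace IsCocycle

/-- The class of a point of the trivial bundle. -/
def toTotal (hc : IsCocycle p c) (x : TrivialTotal Γ N) : hc.Total := Quotient.mk hc.setoid x

theorem toTotal_eq_iff (hc : IsCocycle p c) {x y : TrivialTotal Γ N} :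
    hc.toTotal x = hc.toTotal y ↔ p x.1 = p y.1 ∧ x.2 = c x.1 y.1 * y.2 :=
  Quotient.eq (r := hc.setoid)

theorem toTotal_surjective (hc : IsCocycle p c) : Function.Surjective hc.toTotal :=
  Quotient.mk_surjective

theorem isQuotientMap_toTotal (hc : IsCocycle p c) : IsQuotientMap hc.toTotal :=
  isQuotientMap_quotient_mk'

/-- The bundle projection. -/
def proj (hc : IsCocycle p c) : hc.Total → M :=
  Quotient.lift (fun x : TrivialTotal Γ N => p x.1) fun _ _ h => h.1

theorem proj_toTotal (hc : IsCocycle p c) (x : TrivialTotal Γ N) :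
    hc.proj (hc.toTotal x) = p x.1 := rfl

theorem eventually_trivial_snd_eq (x : TrivialTotal Γ N) : ∀ᶠ y in 𝓝 x, y.2 = x.2 := by
  let : TopologicalSpace Γ := ⊥
  have : DiscreteTopology Γ := ⟨rfl⟩
  have hs : IsOpen {y : TrivialTotal Γ N | y.2 = x.2} :=
    (isOpen_discrete ({x.2} : Set Γ)).preimage (continuous_snd (X := N) (Y := Γ))
  exact hs.mem_nhds rfl

theorem continuous_trivial_section (γ : Γ) :
    Continuous (fun m : N => trivialPoint m γ) := by
  let : TopologicalSpace Γ := ⊥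
  exact (continuous_id (X := N)).prodMk continuous_const

/-- A point `z` near a representative `x` of the class of `y ∈ U` is equivalent to the point of the
sheet `y.2` above `s (p z.1)`, where `s` is a local section through `y.1`. Local constancy of the
cocycle keeps the `Γ`-coordinate equal to `y.2`, and continuity puts that point in `U`. -/
theorem isOpenMap_toTotal (hc : IsCocycle p c) (hp : IsEtaleCover I I' p) : IsOpenMap hc.toTotal := by
  intro U hU
  rw [← hc.isQuotientMap_toTotal.isOpen_preimage, isOpen_iff_mem_nhds]
  rintro x ⟨y, hy, hyx⟩
  obtain ⟨h1, h2⟩ := hc.toTotal_eq_iff.mp hyx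
  obtain ⟨s, hs, hsn, hps⟩ := hp.exists_section y.1
  have hfst : Tendsto (fun z : TrivialTotal Γ N => z.1) (𝓝 x) (𝓝 x.1) :=
    (isLocalHomeomorph_trivial_fst (Γ := Γ) (M := N)).continuous.tendsto x
  have hpt : Tendsto (fun z : TrivialTotal Γ N => p z.1) (𝓝 x) (𝓝 (p y.1)) := by
    rw [h1]
    exact (hp.smooth.continuous.tendsto x.1).comp hfst
  have hst : Tendsto (fun z : TrivialTotal Γ N => s (p z.1)) (𝓝 x) (𝓝 y.1) := by
    have := hs.continuousAt.tendsto.comp hpt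
    rwa [hsn] at this
  have h3 := (hst.prodMk hfst) (hc.locallyConstant y.1 x.1 h1)
  have hyU : ∀ᶠ z in 𝓝 x, trivialPoint (s (p z.1)) y.2 ∈ U :=
    ((continuous_trivial_section (Γ := Γ) y.2).tendsto y.1 |>.comp hst) (hU.mem_nhds hy)
  filter_upwards [h3, hyU, hpt hps, eventually_trivial_snd_eq x] with z h4 h5 h6 h7
  have h6' : p (s (p z.1)) = p z.1 := h6
  refine ⟨_, h5, hc.toTotal_eq_iff.mpr ⟨h6', ?_⟩⟩
  exact h2.trans (congrArg₂ (· * ·) (h4 h6').symm h7.symm)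

/-- The composite `proj ∘ toTotal` is a local homeomorphism, so `toTotal` is locally injective;
being also continuous and open, it is a local homeomorphism, and it can be cancelled. -/
theorem isLocalHomeomorph_proj (hc : IsCocycle p c) (hp : IsEtaleCover I I' p) :
    IsLocalHomeomorph hc.proj := by
  have hcomp : IsLocalHomeomorph (hc.proj ∘ hc.toTotal) :=
    hp.isLocalHomeomorph.comp (isLocalHomeomorph_trivial_fst (Γ := Γ) (M := N))
  have hmk : IsLocalHomeomorph hc.toTotal := by
    rw [isLocalHomeomorph_iff_isOpenEmbedding_restrict]
    intro x
    obtain ⟨U, hU, hxU, hinj⟩ := hcomp.isLocallyInjective x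
    refine ⟨U, hU.mem_nhds hxU, .of_continuous_injective_isOpenMap ?_ ?_ ?_⟩
    · exact hc.isQuotientMap_toTotal.continuous.comp continuous_subtype_val
    · intro y z h
      exact Subtype.ext (hinj y.2 z.2 (congrArg hc.proj h))
    · exact (hc.isOpenMap_toTotal hp).comp hU.isOpenMap_subtype_val
  have h := IsLocalHomeomorphOn.of_comp_right (g := hc.proj) (f := hc.toTotal) (s := Set.univ)
    hcomp.isLocalHomeomorphOn hmk.isLocalHomeomorphOn
  rw [Set.image_univ, hc.toTotal_surjective.range_eq] at h
  exact isLocalHomeomorph_iff_isLocalHomeomorphOn_univ.mpr h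

/-- The right translations of the glued bundle. -/
def act (hc : IsCocycle p c) (e : hc.Total) (γ : Γ) : hc.Total :=
  Quotient.map (sa := hc.setoid) (sb := hc.setoid)
    (fun x : TrivialTotal Γ N => trivialPoint x.1 (x.2 * γ))
    (fun x y h => ⟨h.1, by
      have h2 : x.2 = c x.1 y.1 * y.2 := h.2
      exact (congrArg (· * γ) h2).trans (mul_assoc _ _ _)⟩) e

theorem act_toTotal (hc : IsCocycle p c) (n : N) (δ γ : Γ) :
    hc.act (hc.toTotal (trivialPoint n δ)) γ = hc.toTotal (trivialPoint n (δ * γ)) := rfl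

theorem toTotal_point_eq_iff (hc : IsCocycle p c) {n n' : N} {δ δ' : Γ} :
    hc.toTotal (trivialPoint n δ) = hc.toTotal (trivialPoint n' δ') ↔
      p n = p n' ∧ δ = c n n' * δ' :=
  hc.toTotal_eq_iff

theorem exists_toTotal_point (hc : IsCocycle p c) (e : hc.Total) :
    ∃ n δ, hc.toTotal (trivialPoint n δ) = e := by
  obtain ⟨x, rfl⟩ := hc.toTotal_surjective e
  exact ⟨x.1, x.2, rfl⟩

theorem continuous_act (hc : IsCocycle p c) (γ : Γ) : Continuous fun e => hc.act e γ := by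
  refine hc.isQuotientMap_toTotal.continuous_iff.mpr (hc.isQuotientMap_toTotal.continuous.comp
    (f := fun x : TrivialTotal Γ N => trivialPoint x.1 (x.2 * γ)) ?_)
  let : TopologicalSpace Γ := ⊥
  have : DiscreteTopology Γ := ⟨rfl⟩
  have hm : Continuous fun x : Γ => x * γ := continuous_of_discreteTopology
  exact (continuous_fst (X := N) (Y := Γ)).prodMk (hm.comp (continuous_snd (X := N) (Y := Γ)))

end IsCocycle

/-- Descent of maps into the stack along an étale cover `p : N → M`: a smooth map `f : N → G` and a
cocycle that intertwines its values on the fibres of `p` define a map on `M`. -/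
theorem exists_stackMap_of_cocycle (X : DiscreteCrossedModule V Γ G) [IsManifold I ∞ M]
    (hp : IsEtaleCover I I' p) (hc : IsCocycle p c) {f : N → G} (hf : ContMDiff I' 𝓘(ℝ, V) ∞ f)
    (hfc : ∀ n n', p n = p n' → f n' = (X.bd (c n n'))⁻¹ * f n) :
    ∃ (P : X.StackMap I M) (σ : N → P.E), ContMDiff I' I ∞ σ ∧ (∀ n, P.a (σ n) = p n) ∧
      (∀ n, P.b (σ n) = f n) ∧ ∀ n n', p n = p n' → σ n' = P.act (σ n) (c n n') := by
  let : ChartedSpace H hc.Total := etaleChartedSpace hc.proj (hc.isLocalHomeomorph_proj hp)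
  have : IsManifold I ∞ hc.Total := etale_isManifold hc.proj (hc.isLocalHomeomorph_proj hp)
  have ha : IsLocalDiffeomorph I I ∞ hc.proj :=
    etale_isLocalDiffeomorph hc.proj (hc.isLocalHomeomorph_proj hp)
  let b : hc.Total → G := Quotient.lift (fun x : TrivialTotal Γ N => (X.bd x.2)⁻¹ * f x.1) (by
    rintro x y ⟨h1, h2⟩
    rw [hfc _ _ h1, h2, map_mul, mul_inv_rev, mul_assoc])
  have hb : ∀ x, b (hc.toTotal x) = (X.bd x.2)⁻¹ * f x.1 := fun _ => rfl
  let P : X.StackMap I M :=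
    { E := hc.Total
      a := hc.proj
      b := b
      act := hc.act
      act_one := by
        intro e
        obtain ⟨n, δ, rfl⟩ := hc.exists_toTotal_point e
        rw [hc.act_toTotal, mul_one]
      act_mul := by
        intro e γ γ'
        obtain ⟨n, δ, rfl⟩ := hc.exists_toTotal_point e
        rw [hc.act_toTotal, hc.act_toTotal, hc.act_toTotal, mul_assoc]
      act_smooth := fun γ => by
        refine contMDiff_of_comp_isLocalDiffeomorph ha (hc.continuous_act γ) ?_
        convert ha.contMDiff using 1
        funext e
        obtain ⟨n, δ, rfl⟩ := hc.exists_toTotal_point e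
        rfl
      a_etale := ha
      a_surj := fun m => by
        obtain ⟨n, rfl⟩ := hp.surjective m
        exact ⟨hc.toTotal (trivialPoint n 1), rfl⟩
      a_act := by
        intro e γ
        obtain ⟨n, δ, rfl⟩ := hc.exists_toTotal_point e
        rfl
      principal := by
        intro e e' h
        obtain ⟨n, δ, rfl⟩ := hc.exists_toTotal_point e
        obtain ⟨n', δ', rfl⟩ := hc.exists_toTotal_point e'
        have h' : p n = p n' := h
        refine ⟨δ⁻¹ * (c n n' * δ'), ?_, fun γ hγ => ?_⟩
        · exact (hc.toTotal_point_eq_iff.mpr ⟨h', mul_inv_cancel_left _ _⟩).symm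
        · exact eq_inv_mul_of_mul_eq (hc.toTotal_point_eq_iff.mp (Eq.symm hγ)).2
      b_smooth := by
        intro e
        obtain ⟨x, rfl⟩ := hc.toTotal_surjective e
        obtain ⟨s, hs, hsn, hps⟩ := hp.exists_section x.1
        have h1 : ContMDiffAt I 𝓘(ℝ, V) ∞ (fun m => (X.bd x.2)⁻¹ * f (s m)) (p x.1) :=
          ((contMDiff_mul_left (I := 𝓘(ℝ, V)) (n := ∞) (a := (X.bd x.2)⁻¹)).comp hf
            (s (p x.1))).comp (p x.1) hs
        have h2 : ContMDiffAt I 𝓘(ℝ, V) ∞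
            (fun e => (X.bd x.2)⁻¹ * f (s (hc.proj e))) (hc.toTotal x) :=
          ContMDiffAt.comp (g := fun m => (X.bd x.2)⁻¹ * f (s m)) (hc.toTotal x) h1 (ha.contMDiff _)
        refine h2.congr_of_eventuallyEq ?_
        have h3 : ∀ᶠ n in 𝓝 x.1, s (p n) = n :=
          hp.eventually_section_apply hs.continuousAt hsn hps
        have h4 : ∀ᶠ y in 𝓝 x, b (hc.toTotal y) = (X.bd x.2)⁻¹ * f (s (hc.proj (hc.toTotal y))) := by
          have hfst : Tendsto (fun z : TrivialTotal Γ N => z.1) (𝓝 x) (𝓝 x.1) :=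
            (isLocalHomeomorph_trivial_fst (Γ := Γ) (M := N)).continuous.tendsto x
          filter_upwards [hfst h3, IsCocycle.eventually_trivial_snd_eq x] with y h5 h6
          have h5' : s (p y.1) = y.1 := h5
          rw [hb, hc.proj_toTotal, h5', h6]
        -- The local formula for `b` was proved upstairs, near `x`; openness of `toTotal` carries it
        -- down to the quotient.
        have h7 := (hc.isOpenMap_toTotal hp).image_mem_nhds h4
        filter_upwards [h7] with e he
        obtain ⟨y, hy, rfl⟩ := he
        exact hy
      b_act := by
        intro e γ
        obtain ⟨n, δ, rfl⟩ := hc.exists_toTotal_point e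
        rw [hc.act_toTotal, hb, hb]
        change (X.bd (δ * γ))⁻¹ * f n = (X.bd γ)⁻¹ * ((X.bd δ)⁻¹ * f n)
        rw [map_mul, mul_inv_rev, mul_assoc] }
  refine ⟨P, fun n => hc.toTotal (trivialPoint n 1), ?_, fun _ => rfl, fun n => ?_, fun n n' h => ?_⟩
  · refine contMDiff_of_comp_isLocalDiffeomorph ha ?_ hp.smooth
    exact hc.isQuotientMap_toTotal.continuous.comp (IsCocycle.continuous_trivial_section 1)
  · change (X.bd 1)⁻¹ * f n = f n
    rw [map_one, inv_one, one_mul]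
  · change hc.toTotal _ = hc.act (hc.toTotal _) _
    rw [hc.act_toTotal, hc.toTotal_point_eq_iff]
    refine ⟨h.symm, ?_⟩
    rw [one_mul, hc.mul_symm h.symm]

end Descent

end DiscreteCrossedModule

end

noncomputable section

open Topology Filter

namespace DiscreteCrossedModule

/-! ### Smooth approximation of paths and homotopies in a Lie group -/

section LieGroup

variable {V : Type w} [NormedAddCommGroup V] [NormedSpace ℝ V]
  {G : Type v} [TopologicalSpace G] [ChartedSpace V G] [Group G] [LieGroup 𝓘(ℝ, V) ∞ G]

/-- Small neighbourhoods of `1` in a Lie group contract smoothly onto `1`, through a contraction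
`K` that is constant for small and for large times. -/
theorem exists_contraction {O : Set G} (hO : O ∈ 𝓝 (1 : G)) :
    ∃ (W : Set G) (K : ℝ → G → G), IsOpen W ∧ 1 ∈ W ∧ W ⊆ O ∧
      ContMDiffOn (𝓘(ℝ, ℝ).prod 𝓘(ℝ, V)) 𝓘(ℝ, V) ∞ (fun x : ℝ × G => K x.1 x.2)
        (Set.univ ×ˢ W) ∧
      (∀ s, ∀ u ∈ W, K s u ∈ W) ∧ (∀ s, K s 1 = 1) ∧
      (∀ u ∈ W, ∀ s ≤ 1 / 3, K s u = 1) ∧ ∀ u ∈ W, ∀ s ≥ 2 / 3, K s u = u := by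
  let φ : OpenPartialHomeomorph G V := chartAt V (1 : G)
  have h1 : (1 : G) ∈ φ.source := mem_chart_source V 1
  have hnhds : φ.target ∩ φ.symm ⁻¹' O ∈ 𝓝 (φ 1) := by
    refine inter_mem (φ.open_target.mem_nhds (φ.map_source h1)) ?_
    have := (φ.continuousAt_symm (φ.map_source h1)).tendsto
    rw [φ.left_inv h1] at this
    exact this hO
  obtain ⟨r, hr, hball⟩ := Metric.mem_nhds_iff.mp hnhds
  -- The argument `3s - 1` is at most `0` for `s ≤ 1/3` and at least `1` for `s ≥ 2/3`.
  let χ : ℝ → ℝ := fun s => Real.smoothTransition (3 * s - 1)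
  have hχ : ContDiff ℝ ∞ χ :=
    Real.smoothTransition.contDiff.comp ((contDiff_const.mul contDiff_id).sub contDiff_const)
  -- A ball in the chart, so that the segments towards `φ 1` stay inside.
  let W : Set G := φ.source ∩ φ ⁻¹' Metric.ball (φ 1) r
  let k : ℝ × G → V := fun x => φ 1 + χ x.1 • (φ x.2 - φ 1)
  have hk : ∀ s, ∀ u ∈ W, k (s, u) ∈ Metric.ball (φ 1) r := by
    intro s u hu
    have hu2 := hu.2
    rw [Set.mem_preimage, mem_ball_iff_norm] at hu2
    rw [mem_ball_iff_norm, add_sub_cancel_left, norm_smul, Real.norm_of_nonneg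
      (Real.smoothTransition.nonneg _)]
    exact (mul_le_of_le_one_left (norm_nonneg _) (Real.smoothTransition.le_one _)).trans_lt hu2
  refine ⟨W, fun s u => φ.symm (k (s, u)), ?_, ⟨h1, Metric.mem_ball_self hr⟩, ?_, ?_, ?_, ?_, ?_,
    ?_⟩
  · exact φ.continuousOn.isOpen_inter_preimage φ.open_source Metric.isOpen_ball
  · intro u hu
    have := (hball hu.2).2
    rwa [Set.mem_preimage, φ.left_inv hu.1] at this
  · have h2 : ContMDiffOn 𝓘(ℝ, V) 𝓘(ℝ, V) ∞ φ φ.source := contMDiffOn_chart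
    have h3 : ContMDiffOn 𝓘(ℝ, V) 𝓘(ℝ, V) ∞ φ.symm φ.target := contMDiffOn_chart_symm
    have h4 : ContMDiffOn (𝓘(ℝ, ℝ).prod 𝓘(ℝ, V)) 𝓘(ℝ, V) ∞ (fun x : ℝ × G => φ x.2)
        (Set.univ ×ˢ W) := h2.comp contMDiffOn_snd fun x hx => hx.2.1
    have h5 : ContMDiffOn (𝓘(ℝ, ℝ).prod 𝓘(ℝ, V)) 𝓘(ℝ, ℝ) ∞ (fun x : ℝ × G => χ x.1)
        (Set.univ ×ˢ W) := (hχ.contMDiff.comp contMDiff_fst).contMDiffOn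
    have h6 : ContMDiffOn (𝓘(ℝ, ℝ).prod 𝓘(ℝ, V)) 𝓘(ℝ, V) ∞ k (Set.univ ×ˢ W) :=
      contMDiffOn_const.add (h5.smul (h4.sub contMDiffOn_const))
    exact h3.comp h6 fun x hx => (hball (hk x.1 x.2 hx.2)).1
  · intro s u hu
    have h2 := (hball (hk s u hu)).1
    refine ⟨φ.map_target h2, ?_⟩
    rw [Set.mem_preimage, φ.right_inv h2]
    exact hk s u hu
  · intro s
    change φ.symm (φ 1 + χ s • (φ 1 - φ 1)) = 1
    rw [sub_self, smul_zero, add_zero, φ.left_inv h1]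
  · intro u hu s hs
    have : χ s = 0 := Real.smoothTransition.zero_of_nonpos (by linarith)
    change φ.symm (φ 1 + χ s • (φ u - φ 1)) = 1
    rw [this, zero_smul, add_zero, φ.left_inv h1]
  · intro u hu s hs
    have : χ s = 1 := Real.smoothTransition.one_of_one_le (by linarith)
    change φ.symm (φ 1 + χ s • (φ u - φ 1)) = u
    rw [this, one_smul, add_sub_cancel, φ.left_inv hu.1]

/-- A smooth path `f : ℝ → G` that starts at `1` and satisfies `f (t + 1) = c * f t`. -/
structure IsTwistedPath (c : G) (f : ℝ → G) : Prop where
  smooth : ContMDiff 𝓘(ℝ, ℝ) 𝓘(ℝ, V) ∞ f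
  zero : f 0 = 1
  add_one : ∀ t, f (t + 1) = c * f t

/-- A smooth homotopy through twisted paths. -/
def TwistedHomotopic (c : G) (f g : ℝ → G) : Prop :=
  ∃ F : ℝ × ℝ → G, ContMDiff (𝓘(ℝ, ℝ).prod 𝓘(ℝ, ℝ)) 𝓘(ℝ, V) ∞ F ∧
    (∀ t, F (t, 0) = f t) ∧ (∀ t, F (t, 1) = g t) ∧ (∀ s, F (0, s) = 1) ∧
    ∀ t s, F (t + 1, s) = c * F (t, s)

theorem apply_add_intCast {c : G} {f : ℝ → G} (h : ∀ t, f (t + 1) = c * f t) (t : ℝ) (k : ℤ) :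
    f (t + k) = c ^ k * f t := by
  induction k with
  | zero => simp
  | succ i ih =>
    have : t + ((i + 1 : ℤ) : ℝ) = (t + (i : ℤ)) + 1 := by push_cast; ring
    rw [this, h, ih, ← mul_assoc, ← zpow_one_add, add_comm]
  | pred i ih =>
    have h1 := h (t + ((-i - 1 : ℤ) : ℝ))
    have : t + ((-i - 1 : ℤ) : ℝ) + 1 = t + (-i : ℤ) := by push_cast; ring
    rw [this, ih] at h1
    have h2 : c ^ (-i - 1 : ℤ) = c⁻¹ * c ^ (-i : ℤ) := by
      rw [← zpow_neg_one, ← zpow_add]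
      congr 1
      ring
    rw [h2, mul_assoc, h1, inv_mul_cancel_left]

theorem apply_fract {c : G} {f : ℝ → G} (h : ∀ t, f (t + 1) = c * f t) (t : ℝ) :
    f t = c ^ ⌊t⌋ * f (Int.fract t) := by
  rw [← apply_add_intCast h, Int.fract_add_floor]

/-- The factor `c` cancels in `f⁻¹ g`, which is therefore 1-periodic. -/
theorem forall_inv_mul_mem {c : G} {f g : ℝ → G} (hf : ∀ t, f (t + 1) = c * f t)
    (hg : ∀ t, g (t + 1) = c * g t) {W : Set G} (h : ∀ t ∈ unitInterval, (f t)⁻¹ * g t ∈ W) (t : ℝ) :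
    (f t)⁻¹ * g t ∈ W := by
  rw [apply_fract hf, apply_fract hg, mul_inv_rev, mul_assoc, inv_mul_cancel_left]
  exact h _ ⟨Int.fract_nonneg t, (Int.fract_lt_one t).le⟩

theorem TwistedHomotopic.symm {c : G} {f g : ℝ → G} (h : TwistedHomotopic (V := V) c f g) :
    TwistedHomotopic (V := V) c g f := by
  obtain ⟨F, h1, h2, h3, h4, h5⟩ := h
  refine ⟨fun x => F (x.1, 1 - x.2), h1.comp (contMDiff_fst.prodMk ?_), fun t => ?_, fun t => ?_,
    fun s => h4 _, fun t s => h5 _ _⟩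
  · exact (contDiff_const.sub contDiff_id).contMDiff.comp contMDiff_snd
  · simp only [sub_zero, h3]
  · simp only [sub_self, h2]

/-- The pointwise product `F g⁻¹ F'` replaces pasting in the parameter `s`: it is smooth at once,
and at each end one of the two homotopies equals `g` and cancels. -/
theorem TwistedHomotopic.trans {c : G} {f g k : ℝ → G}
    (hg : IsTwistedPath (V := V) c g) (h : TwistedHomotopic (V := V) c f g)
    (h' : TwistedHomotopic (V := V) c g k) : TwistedHomotopic (V := V) c f k := by
  obtain ⟨F, h1, h2, h3, h4, h5⟩ := h
  obtain ⟨F', h1', h2', h3', h4', h5'⟩ := h'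
  refine ⟨fun x => F x * (g x.1)⁻¹ * F' x, (h1.mul (hg.smooth.comp contMDiff_fst).inv).mul h1',
    fun t => ?_, fun t => ?_, fun s => ?_, fun t s => ?_⟩
  · simp only [h2, h2', inv_mul_cancel_right]
  · simp only [h3, h3', mul_inv_cancel, one_mul]
  · simp only [h4, h4', hg.zero, inv_one, one_mul]
  · simp only [h5, h5', hg.add_one, mul_inv_rev, mul_assoc, inv_mul_cancel_left]

/-- Twisted paths that are close to each other are homotopic. -/
theorem exists_nhds_twistedHomotopic (G : Type v) [TopologicalSpace G] [ChartedSpace V G] [Group G]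
    [LieGroup 𝓘(ℝ, V) ∞ G] : ∃ W ∈ 𝓝 (1 : G), ∀ (c : G) (f g : ℝ → G),
      IsTwistedPath (V := V) c f → IsTwistedPath (V := V) c g →
      (∀ t ∈ unitInterval, (f t)⁻¹ * g t ∈ W) → TwistedHomotopic (V := V) c f g := by
  obtain ⟨W, K, hW, h1, -, hK, hKW, hK1, hK2, hK3⟩ :=
    exists_contraction (V := V) (G := G) univ_mem
  refine ⟨W, hW.mem_nhds h1, fun c f g hf hg hfg => ?_⟩
  have hfg' := forall_inv_mul_mem hf.add_one hg.add_one hfg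
  refine ⟨fun x => f x.1 * K x.2 ((f x.1)⁻¹ * g x.1), (hf.smooth.comp contMDiff_fst).mul ?_,
    fun t => ?_, fun t => ?_, fun s => ?_, fun t s => ?_⟩
  · have h2 : ContMDiff (𝓘(ℝ, ℝ).prod 𝓘(ℝ, ℝ)) (𝓘(ℝ, ℝ).prod 𝓘(ℝ, V)) ∞
        (fun x : ℝ × ℝ => (x.2, (f x.1)⁻¹ * g x.1)) :=
      contMDiff_snd.prodMk ((hf.smooth.inv.mul hg.smooth).comp contMDiff_fst)
    exact hK.comp_contMDiff h2 fun x => ⟨trivial, hfg' x.1⟩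
  · simp only [hK2 _ (hfg' t) 0 (by norm_num), mul_one]
  · simp only [hK3 _ (hfg' t) 1 (by norm_num), mul_inv_cancel_left]
  · simp only [hf.zero, hg.zero, inv_one, one_mul, hK1]
  · simp only [hf.add_one, hg.add_one, mul_inv_rev, mul_assoc, inv_mul_cancel_left]

/-- A path from `1` to `c` that is constant near its end points extends to a twisted path. -/
theorem exists_isTwistedPath_of_flat {c : G} {g : ℝ → G} (hg : ContMDiff 𝓘(ℝ, ℝ) 𝓘(ℝ, V) ∞ g)
    {ε : ℝ} (hε : 0 < ε) (h0 : ∀ t < ε, g t = 1) (h1 : ∀ t > 1 - ε, g t = c) :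
    ∃ f, IsTwistedPath (V := V) c f ∧ (∀ t ∈ unitInterval, f t = g t) ∧ ∀ᶠ t in 𝓝 0, f t = 1 := by
  let f : ℝ → G := fun t => c ^ ⌊t⌋ * g (Int.fract t)
  have hadd : ∀ t, f (t + 1) = c * f t := fun t => by
    simp only [f, Int.floor_add_one, Int.fract_add_one, ← mul_assoc, ← zpow_one_add, add_comm]
  -- Around an integer `k` both branches of the floor agree: on the left `c ^ (k - 1)` times the
  -- final value `c`, on the right `c ^ k` times the initial value `1`.
  have hloc : ∀ k : ℤ, ∀ t ∈ Set.Ioo (k - min ε 1 : ℝ) (k + 1), f t = c ^ k * g (t - k) := by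
    intro k t ht
    rcases lt_or_ge t k with h | h
    · have h2 : ⌊t⌋ = k - 1 := by
        rw [Int.floor_eq_iff]
        push_cast
        exact ⟨by linarith [ht.1, min_le_right ε 1], by linarith⟩
      have h3 : g (Int.fract t) = c := by
        apply h1
        rw [Int.fract, h2]
        push_cast
        linarith [ht.1, min_le_left ε 1]
      simp only [f]
      rw [h3, h2, h0 (t - k) (by linarith), mul_one, zpow_sub_one, inv_mul_cancel_right]
    · have h2 : ⌊t⌋ = k := Int.floor_eq_iff.mpr ⟨h, ht.2⟩
      simp only [f, Int.fract, h2]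
  have hmin : 0 < min ε 1 := lt_min hε one_pos
  refine ⟨f, ⟨fun t => ?_, ?_, hadd⟩, fun t ht => ?_, ?_⟩
  · have h2 : ContMDiff 𝓘(ℝ, ℝ) 𝓘(ℝ, V) ∞ (fun s : ℝ => c ^ ⌊t⌋ * g (s - ⌊t⌋)) :=
      (contMDiff_mul_left (I := 𝓘(ℝ, V)) (n := ∞) (a := c ^ ⌊t⌋)).comp
        (hg.comp (contDiff_id.sub contDiff_const).contMDiff)
    refine (h2 t).congr_of_eventuallyEq ?_
    filter_upwards [Ioo_mem_nhds (a := (⌊t⌋ - min ε 1 : ℝ)) (b := ⌊t⌋ + 1)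
      (by linarith [Int.floor_le t]) (Int.lt_floor_add_one t)] with s hs
    exact hloc _ s hs
  · simp [f, h0 0 hε]
  · rcases eq_or_lt_of_le ht.2 with rfl | h
    · simp [f, h0 0 hε, h1 1 (by linarith)]
    · have h2 : ⌊t⌋ = 0 := Int.floor_eq_iff.mpr ⟨by simpa using ht.1, by simpa using h⟩
      simp [f, h2, Int.fract_eq_self.mpr ⟨ht.1, h⟩]
  · filter_upwards [Ioo_mem_nhds (a := -min ε 1) (b := min ε 1) (by linarith) hmin] with t ht
    have := hloc 0 t ⟨by simpa using ht.1, by simpa using ht.2.trans_le (min_le_right _ _)⟩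
    rw [this, h0 _ (by simpa using ht.2.trans_le (min_le_left _ _)), zpow_zero, one_mul]

/-- A twisted path that is constant near `0` agrees on the unit interval with a path that is
constant outside a smaller interval. -/
theorem IsTwistedPath.exists_flat {c : G} {f : ℝ → G} (hf : IsTwistedPath (V := V) c f)
    (h0 : ∀ᶠ t in 𝓝 0, f t = 1) :
    ∃ g : ℝ → G, ContMDiff 𝓘(ℝ, ℝ) 𝓘(ℝ, V) ∞ g ∧ (∀ t ∈ unitInterval, g t = f t) ∧
      ∃ ε > 0, (∀ t < ε, g t = 1) ∧ ∀ t > 1 - ε, g t = c := by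
  obtain ⟨δ, hδ, hball⟩ := Metric.eventually_nhds_iff.mp h0
  have hsmall : ∀ t, |t| < δ → f t = 1 := fun t ht => hball (by simpa using ht)
  have hone : ∀ t, |t - 1| < δ → f t = c := fun t ht => by
    have := hf.add_one (t - 1)
    rwa [sub_add_cancel, hsmall _ ht, mul_one] at this
  -- Cut off outside the unit interval by the constants `1` and `c`, which `f` already takes near
  -- the end points.
  let g : ℝ → G := fun t => if t < 0 then 1 else if 1 < t then c else f t
  have hε : 0 < min δ (1 / 2) := lt_min hδ (by norm_num)
  have hε1 := min_le_left δ (1 / 2)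
  have hε2 := min_le_right δ (1 / 2)
  have hg0 : ∀ t < min δ (1 / 2), g t = 1 := fun t ht => by
    simp only [g]
    split_ifs with h1 h2
    · rfl
    · linarith
    · exact hsmall t (by rw [abs_of_nonneg (not_lt.mp h1)]; linarith)
  have hg1 : ∀ t > 1 - min δ (1 / 2), g t = c := fun t ht => by
    simp only [g]
    split_ifs with h1 h2
    · linarith
    · rfl
    · exact hone t (by rw [abs_lt]; constructor <;> linarith)
  refine ⟨g, fun t => ?_, fun t ht => ?_, _, hε, hg0, hg1⟩
  · rcases lt_or_ge t (min δ (1 / 2)) with h | h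
    · exact contMDiffAt_const.congr_of_eventuallyEq
        ((eventually_lt_nhds h).mono fun s hs => hg0 s hs)
    rcases lt_or_ge (1 - min δ (1 / 2)) t with h' | h'
    · exact contMDiffAt_const.congr_of_eventuallyEq
        ((eventually_gt_nhds h').mono fun s hs => hg1 s hs)
    · refine (hf.smooth t).congr_of_eventuallyEq ?_
      filter_upwards [Ioo_mem_nhds (hε.trans_le h) (show t < 1 by linarith)] with s hs
      simp only [g, if_neg hs.1.not_gt, if_neg hs.2.not_gt]
  · simp only [g, if_neg ht.1.not_gt, if_neg ht.2.not_gt]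

/-- The condition defines an open neighbourhood of the diagonal of a compact interval, hence an
entourage. -/
theorem exists_uniform_inv_mul_mem [IsTopologicalGroup G] {x y : G} (h : Path x y) {W : Set G}
    (hW : IsOpen W) (h1 : 1 ∈ W) : ∃ n : ℕ, 0 < n ∧ ∀ s ∈ unitInterval, ∀ t ∈ unitInterval,
      |s - t| ≤ 1 / n → (h.extend s)⁻¹ * h.extend t ∈ W := by
  have hopen : IsOpen {q : unitInterval × unitInterval | (h q.1)⁻¹ * h q.2 ∈ W} :=
    hW.preimage ((h.continuous.comp continuous_fst).inv.mul (h.continuous.comp continuous_snd))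
  have hmem : {q : unitInterval × unitInterval | (h q.1)⁻¹ * h q.2 ∈ W} ∈
      uniformity unitInterval := by
    rw [← nhdsSet_diagonal_eq_uniformity, hopen.mem_nhdsSet]
    rintro ⟨s, t⟩ hst
    obtain rfl : s = t := hst
    simpa using h1
  obtain ⟨ε, hε, hball⟩ := Metric.mem_uniformity_dist.mp hmem
  obtain ⟨n, hn⟩ := exists_nat_one_div_lt hε
  refine ⟨n + 1, n.succ_pos, fun s hs t ht hst => ?_⟩
  rw [h.extend_apply hs, h.extend_apply ht]
  refine hball (a := ⟨s, hs⟩) (b := ⟨t, ht⟩) (lt_of_le_of_lt ?_ hn)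
  push_cast at hst
  exact hst

/-- Every path from `1` to `c` is close to a smooth twisted path. -/
theorem exists_isTwistedPath_near [IsTopologicalGroup G] {c : G} (h : Path 1 c) {O : Set G}
    (hO : O ∈ 𝓝 (1 : G)) :
    ∃ f, IsTwistedPath (V := V) c f ∧ (∀ᶠ t in 𝓝 0, f t = 1) ∧
      ∀ t ∈ unitInterval, (h.extend t)⁻¹ * f t ∈ O := by
  obtain ⟨U, hU, hU1, hUO⟩ := exists_open_nhds_one_split hO
  obtain ⟨W, K, hW, hW1, hWU, hK, hKW, hK1, hK2, hK3⟩ :=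
    exists_contraction (V := V) (hU.mem_nhds hU1)
  obtain ⟨n, hn, hunif⟩ := exists_uniform_inv_mul_mem h hW hW1
  have hn' : (0 : ℝ) < n := Nat.cast_pos.mpr hn
  -- Induction over the subdivision points: each step multiplies by a contraction path towards
  -- `h((k-1)/n)⁻¹ h(k/n)`. The slack `1/3` matches the times at which `K` is constant, so that each
  -- factor starts only when the preceding ones have stopped.
  have key : ∀ k : ℕ, k ≤ n → ∃ g : ℝ → G, ContMDiff 𝓘(ℝ, ℝ) 𝓘(ℝ, V) ∞ g ∧
      (∀ t : ℝ, n * t ≤ 1 / 3 → g t = 1) ∧ (∀ t : ℝ, k - 1 / 3 ≤ n * t → g t = h.extend (k / n)) ∧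
      ∀ t : ℝ, 0 ≤ t → n * t ≤ k → (h.extend t)⁻¹ * g t ∈ O := by
    intro k
    induction k with
    | zero =>
      intro _
      refine ⟨fun _ => 1, contMDiff_const, fun _ _ => rfl, fun t _ => ?_, fun t h0 h1 => ?_⟩
      · simp
      · have : t = 0 := by
          rw [Nat.cast_zero] at h1
          exact le_antisymm (nonpos_of_mul_nonpos_right h1 hn') h0
        rw [this, h.extend_zero]
        simpa using mem_of_mem_nhds hO
    | succ k ih =>
      intro hk
      have hk' : (k : ℝ) + 1 ≤ n := by exact_mod_cast hk
      have hk0 : (0 : ℝ) ≤ k := k.cast_nonneg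
      obtain ⟨g, hg, hg0, hg1, hgO⟩ := ih (Nat.le_of_succ_le hk)
      have hkI : (k / n : ℝ) ∈ unitInterval := ⟨by positivity, (div_le_one hn').mpr (by linarith)⟩
      have hkI' : ((k + 1) / n : ℝ) ∈ unitInterval := ⟨by positivity, (div_le_one hn').mpr hk'⟩
      have hu : (h.extend (k / n))⁻¹ * h.extend ((k + 1) / n) ∈ W := by
        refine hunif _ hkI _ hkI' ?_
        rw [← sub_div, abs_div, abs_of_pos hn']
        simp
      set u : G := (h.extend (k / n))⁻¹ * h.extend ((k + 1) / n) with hudef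
      refine ⟨fun t => g t * K (n * t - k) u, hg.mul ?_, fun t ht => ?_, fun t ht => ?_,
        fun t ht0 ht => ?_⟩
      · have h2 : ContMDiff 𝓘(ℝ, ℝ) (𝓘(ℝ, ℝ).prod 𝓘(ℝ, V)) ∞ (fun t : ℝ => (n * t - k, u)) :=
          ((contDiff_const.mul contDiff_id).sub contDiff_const).contMDiff.prodMk contMDiff_const
        exact hK.comp_contMDiff h2 fun t => ⟨trivial, hu⟩
      · simp only
        rw [hg0 t ht, hK2 u hu _ (by linarith), one_mul]
      · push_cast at ht ⊢
        rw [hg1 t (by linarith), hK3 u hu _ (by linarith), hudef, mul_inv_cancel_left]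
      · push_cast at ht
        simp only
        rcases le_total (n * t) k with h2 | h2
        · rw [hK2 u hu _ (by linarith), mul_one]
          exact hgO t ht0 h2
        -- On the new piece the old path rests at `h(k/n)`, so the error is a product of two
        -- elements of `W ⊆ U`, which lies in `O`.
        · rw [hg1 t (by linarith), ← mul_assoc]
          refine hUO _ (hWU ?_) _ (hWU (hKW _ u hu))
          have htn : t ≤ 1 := by
            have : n * t ≤ n * 1 := by linarith
            exact le_of_mul_le_mul_left this hn'
          refine hunif t ⟨ht0, htn⟩ _ hkI ?_
          have h3 : t - k / n = (n * t - k) / n := by field_simp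
          rw [h3, abs_div, abs_of_pos hn', abs_of_nonneg (by linarith)]
          gcongr
          linarith
  obtain ⟨g, hg, hg0, hg1, hgO⟩ := key n le_rfl
  have hg1' : ∀ t > 1 - 1 / (3 * n : ℝ), g t = c := fun t ht => by
    rw [hg1 t, div_self hn'.ne', h.extend_one]
    have : n * (1 - 1 / (3 * n : ℝ)) = n - 1 / 3 := by field_simp
    rw [← this]
    gcongr
  have hg0' : ∀ t < 1 / (3 * n : ℝ), g t = 1 := fun t ht => by
    apply hg0
    have : n * (1 / (3 * n : ℝ)) = 1 / 3 := by field_simp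
    rw [← this]
    gcongr
  obtain ⟨f, hf, hfg, hf0⟩ := exists_isTwistedPath_of_flat hg (by positivity) hg0' hg1'
  refine ⟨f, hf, hf0, fun t ht => ?_⟩
  rw [hfg t ht]
  exact hgO t ht.1 (mul_le_of_le_one_right hn'.le ht.2)

/-- In a simply connected Lie group, any two twisted paths are smoothly homotopic. -/
theorem IsTwistedPath.homotopic [SimplyConnectedSpace G] {c : G} {f g : ℝ → G}
    (hf : IsTwistedPath (V := V) c f) (hg : IsTwistedPath (V := V) c g) :
    TwistedHomotopic (V := V) c f g := by
  have : IsTopologicalGroup G := topologicalGroup_of_lieGroup 𝓘(ℝ, V) ∞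
  obtain ⟨W, hW, hWh⟩ := exists_nhds_twistedHomotopic (V := V) G
  have hone : ∀ {f : ℝ → G}, IsTwistedPath (V := V) c f → f 1 = c := fun hf => by
    have := hf.add_one 0
    rwa [hf.zero, zero_add, mul_one] at this
  let toPath : ∀ {f : ℝ → G}, IsTwistedPath (V := V) c f → Path (1 : G) c := fun {f} hf =>
    { toFun := fun t => f t
      continuous_toFun := hf.smooth.continuous.comp continuous_subtype_val
      source' := hf.zero
      target' := hone hf }
  obtain ⟨Hm⟩ := SimplyConnectedSpace.paths_homotopic (toPath hf) (toPath hg)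
  -- Comparing approximations of neighbouring paths produces three errors: each approximation
  -- against its own path, and one path against the other.
  have hO : ∃ O ∈ 𝓝 (1 : G), ∀ x ∈ O, ∀ y ∈ O, ∀ z ∈ O, x⁻¹ * y * z ∈ W := by
    have hcont : Tendsto (fun q : G × G × G => q.1⁻¹ * q.2.1 * q.2.2) (𝓝 (1, 1, 1)) (𝓝 1) := by
      have : Continuous fun q : G × G × G => q.1⁻¹ * q.2.1 * q.2.2 := by fun_prop
      simpa using this.tendsto (1, 1, 1)
    have h1 := hcont hW
    rw [nhds_prod_eq, nhds_prod_eq, mem_map, mem_prod_iff] at h1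
    obtain ⟨A, hA, D, hD, hAD⟩ := h1
    obtain ⟨B, hB, C, hC, hBC⟩ := mem_prod_iff.mp hD
    exact ⟨A ∩ (B ∩ C), inter_mem hA (inter_mem hB hC), fun x hx y hy z hz =>
      hAD (Set.mk_mem_prod hx.1 (hBC (Set.mk_mem_prod hy.2.1 hz.2.2)))⟩
  obtain ⟨O, hO, hOW⟩ := hO
  have hO1 := mem_of_mem_nhds hO
  -- No continuity in `s` is asked of the smooth approximations: closeness to the continuous
  -- homotopy suffices.
  choose k hk _ hkO using fun s : unitInterval => exists_isTwistedPath_near (V := V) (Hm.eval s) hO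
  have hkO' : ∀ s t : unitInterval, (Hm (s, t))⁻¹ * k s t ∈ O := fun s t => by
    have := hkO s t t.2
    rwa [(Hm.eval s).extend_apply t.2] at this
  have hnear : ∀ s, ∀ᶠ s' in 𝓝 s, TwistedHomotopic (V := V) c (k s) (k s') := by
    intro s
    have h1 : ∀ᶠ s' in 𝓝 s, ∀ t ∈ (Set.univ : Set unitInterval), (Hm (s, t))⁻¹ * Hm (s', t) ∈ O := by
      refine isCompact_univ.eventually_forall_of_forall_eventually fun t _ => ?_
      have : Continuous fun q : unitInterval × unitInterval => (Hm (s, q.2))⁻¹ * Hm q := by fun_prop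
      have h2 := this.tendsto (s, t)
      simp only [inv_mul_cancel] at h2
      exact h2 hO
    filter_upwards [h1] with s' h2
    refine hWh c _ _ (hk s) (hk s') fun t ht => ?_
    have h3 := hOW _ (hkO' s ⟨t, ht⟩) _ (h2 ⟨t, ht⟩ trivial) _ (hkO' s' ⟨t, ht⟩)
    simpa only [mul_inv_rev, inv_inv, mul_assoc, mul_inv_cancel_left] using h3
  have hall : TwistedHomotopic (V := V) c (k 0) (k 1) := by
    have hs : Std.Symm fun s s' : unitInterval => TwistedHomotopic (V := V) c (k s) (k s') :=
      ⟨fun _ _ h => h.symm⟩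
    -- An equivalence relation whose classes are neighbourhoods of their points has a single class
    -- on the connected interval.
    exact PreconnectedSpace.induction₂
      (fun s s' : unitInterval => TwistedHomotopic (V := V) c (k s) (k s'))
      hnear ⟨fun s s' s'' h h' => h.trans (hk s') h'⟩ 0 1
  have hf0 : TwistedHomotopic (V := V) c f (k 0) := by
    refine hWh c _ _ hf (hk 0) fun t ht => ?_
    have h1 := hOW _ hO1 _ hO1 _ (hkO' 0 ⟨t, ht⟩)
    have h2 : Hm (0, ⟨t, ht⟩) = f t := Hm.apply_zero _
    rwa [h2, inv_one, one_mul, one_mul] at h1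
  have hg1 : TwistedHomotopic (V := V) c g (k 1) := by
    refine hWh c _ _ hg (hk 1) fun t ht => ?_
    have h1 := hOW _ hO1 _ hO1 _ (hkO' 1 ⟨t, ht⟩)
    have h2 : Hm (1, ⟨t, ht⟩) = g t := Hm.apply_one _
    rwa [h2, inv_one, one_mul, one_mul] at h1
  exact (hf0.trans (hk 0) hall).trans (hk 1) hg1.symm

end LieGroup

end DiscreteCrossedModule

end

noncomputable section

open Topology Filter

namespace DiscreteCrossedModule

variable {V : Type w} [NormedAddCommGroup V] [NormedSpace ℝ V]
  {Γ : Type u} [Group Γ] {G : Type v} [TopologicalSpace G] [ChartedSpace V G] [Group G]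
  [LieGroup 𝓘(ℝ, V) ∞ G]

/-! ### Cocycles on the universal cover of the circle -/

/-- On a fibre `t - s` is an integer, so `round` is exact there and only serves to define the
cocycle everywhere; it is locally constant because integers at distance less than `1` are equal. -/
theorem isCocycle_zpow (γ : Γ) : IsCocycle expCircle (fun s t => γ ^ round (t - s)) where
  mul s t r hst htr := by
    obtain ⟨k, rfl⟩ := expCircle_eq_iff.mp hst
    obtain ⟨j, rfl⟩ := expCircle_eq_iff.mp htr
    have h : s + k + j - s = ((k + j : ℤ) : ℝ) := by push_cast; ring
    rw [h, add_sub_cancel_left, add_sub_cancel_left, round_intCast, round_intCast, round_intCast,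
      zpow_add]
  locallyConstant s t hst := by
    obtain ⟨k, rfl⟩ := expCircle_eq_iff.mp hst
    have hcont : Tendsto (fun x : ℝ × ℝ => x.2 - x.1) (𝓝 s ×ˢ 𝓝 (s + k)) (𝓝 k) := by
      rw [← nhds_prod_eq]
      have : Continuous fun x : ℝ × ℝ => x.2 - x.1 := by fun_prop
      simpa using this.tendsto (s, s + k)
    filter_upwards [hcont (Metric.ball_mem_nhds _ one_pos)] with x hx hpx
    obtain ⟨j, hj⟩ := expCircle_eq_iff.mp hpx
    have h1 : x.2 - x.1 = j := by rw [hj, add_sub_cancel_left]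
    rw [Set.mem_preimage, h1, Metric.mem_ball, Int.dist_cast_real, Int.dist_eq,
      ← Int.cast_sub, ← Int.cast_abs] at hx
    have h2 : |j - k| < 1 := by exact_mod_cast hx
    rw [h1, add_sub_cancel_left, round_intCast, round_intCast,
      sub_eq_zero.mp (Int.abs_lt_one_iff.mp h2)]

theorem IsCocycle.prodMap_id {M N : Type} [TopologicalSpace M] [TopologicalSpace N] {p : N → M}
    {c : N → N → Γ} (hc : IsCocycle p c) :
    IsCocycle (Prod.map p (fun s : ℝ => s)) (fun x y => c x.1 y.1) where
  mul x y z hxy hyz := hc.mul _ _ _ (congrArg Prod.fst hxy) (congrArg Prod.fst hyz)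
  locallyConstant x y hxy := by
    have h1 : Tendsto (fun q : (N × ℝ) × (N × ℝ) => (q.1.1, q.2.1)) (𝓝 x ×ˢ 𝓝 y)
        (𝓝 x.1 ×ˢ 𝓝 y.1) := by
      rw [← nhds_prod_eq, ← nhds_prod_eq]
      have : Continuous fun q : (N × ℝ) × (N × ℝ) => (q.1.1, q.2.1) := by fun_prop
      exact this.tendsto (x, y)
    filter_upwards [h1 (hc.locallyConstant x.1 y.1 (congrArg Prod.fst hxy))] with q hq hpq
    exact hq (congrArg Prod.fst hpq)

/-! ### Monodromy -/

variable {X : DiscreteCrossedModule V Γ G}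

section Monodromy

variable {B : Type} [NormedAddCommGroup B] [NormedSpace ℝ B] {H : Type} [TopologicalSpace H]
  {I : ModelWithCorners ℝ B H} {M : Type} [TopologicalSpace M] [ChartedSpace H M]
  {P : X.StackMap I M}

/-- `t ↦ lam (t + 1)` and `t ↦ lam t · γ` lift the same path and agree at `0`. -/
theorem StackMap.lift_add_intCast {lam : ℝ → P.E} (hlam : Continuous lam)
    (ha : ∀ t, P.a (lam (t + 1)) = P.a (lam t)) {γ : Γ} (h : lam 1 = P.act (lam 0) γ) (t : ℝ)
    (k : ℤ) : lam (t + k) = P.act (lam t) (γ ^ k) := by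
  have h1 : ∀ t, lam (t + 1) = P.act (lam t) γ :=
    P.lift_unique (hlam.comp (continuous_add_const 1)) ((P.continuous_act γ).comp hlam)
      (fun t => (ha t).trans (P.a_act _ _).symm) 0 (by simpa using h)
  induction k with
  | zero => simp [P.act_one]
  | succ i ih =>
    have : t + ((i + 1 : ℤ) : ℝ) = (t + (i : ℤ)) + 1 := by push_cast; ring
    rw [this, h1, ih, ← P.act_mul, zpow_add_one]
  | pred i ih =>
    have h2 := h1 (t + ((-i - 1 : ℤ) : ℝ))
    have : t + ((-i - 1 : ℤ) : ℝ) + 1 = t + (-i : ℤ) := by push_cast; ring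
    rw [this, ih] at h2
    rw [zpow_sub_one, P.act_mul, h2, P.act_act_inv]

/-- The monodromy of a lift does not depend on the lift. -/
theorem StackMap.monodromy_eq [PreconnectedSpace G] {lam lam' : ℝ → P.E} (hlam : Continuous lam)
    (hlam' : Continuous lam') (ha : ∀ t, P.a (lam t) = P.a (lam' t)) {γ : Γ}
    (h : lam 1 = P.act (lam 0) γ) : lam' 1 = P.act (lam' 0) γ := by
  obtain ⟨κ, hκ⟩ := P.exists_act (ha 0)
  have h1 := P.lift_unique hlam' ((P.continuous_act κ).comp hlam)
    (fun t => (ha t).symm.trans (P.a_act _ _).symm) 0 hκ 1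
  -- In general the monodromies of `lam` and `lam · κ` are conjugate by `κ`; here they coincide
  -- because `Γ` is commutative.
  rw [h1, Function.comp_apply, h, hκ, ← P.act_mul, ← P.act_mul, X.mul_comm_of_preconnected]

end Monodromy

theorem Loop.exists_base (ℓ : X.Loop) : ∃ e, ℓ.1.a e = 1 ∧ ℓ.1.b e = 1 := by
  obtain ⟨σ, -, h1, h2⟩ := twoIsoComp_unitMap_iff.mp ℓ.2
  exact ⟨σ 0, h1 0, h2 0⟩

theorem Loop.exists_isLift_of_base (ℓ : X.Loop) {e : ℓ.1.E} (ha : ℓ.1.a e = 1)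
    (hb : ℓ.1.b e = 1) : ∃ lam, IsLift ℓ lam ∧ lam 0 = e := by
  obtain ⟨lam, h1, h2, h3⟩ := ℓ.1.exists_lift contMDiff_expCircle 0 e
    (ha.trans expCircle_zero.symm)
  exact ⟨lam, ⟨h1, h2, by rw [h3, hb]⟩, h3⟩

theorem Loop.exists_isLift (ℓ : X.Loop) : ∃ lam, IsLift ℓ lam := by
  obtain ⟨e, ha, hb⟩ := ℓ.exists_base
  obtain ⟨lam, h, -⟩ := ℓ.exists_isLift_of_base ha hb
  exact ⟨lam, h⟩

/-- The anchor at `0` plays no role in the monodromy, so one element serves all continuous lifts. -/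
theorem Loop.exists_diff [PreconnectedSpace G] (ℓ : X.Loop) : ∃ γ, ∀ lam : ℝ → ℓ.1.E,
    Continuous lam → (∀ t, ℓ.1.a (lam t) = expCircle t) → lam 1 = ℓ.1.act (lam 0) γ := by
  obtain ⟨lam, h1, h2, -⟩ := ℓ.exists_isLift
  have h2' : ∀ t, ℓ.1.a (lam t) = expCircle t := h2
  obtain ⟨γ, hγ⟩ := ℓ.1.exists_act (e := lam 0) (e' := lam 1)
    (by rw [h2', h2', expCircle_zero, expCircle_one])
  exact ⟨γ, fun lam' h1' h3 => StackMap.monodromy_eq h1.continuous h1'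
    (fun t => (h2' t).trans (h3 t).symm) hγ⟩

/-- The `Γ`-difference of the lifts of a loop. -/
def Loop.diff [PreconnectedSpace G] (ℓ : X.Loop) : Γ := ℓ.exists_diff.choose

theorem Loop.lift_one [PreconnectedSpace G] (ℓ : X.Loop) {lam : ℝ → ℓ.1.E}
    (h : Continuous lam) (ha : ∀ t, ℓ.1.a (lam t) = expCircle t) :
    lam 1 = ℓ.1.act (lam 0) ℓ.diff :=
  ℓ.exists_diff.choose_spec lam h ha

namespace IsLift

variable [PreconnectedSpace G] {ℓ : X.Loop} {lam : ℝ → ℓ.1.E}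

theorem continuous (h : IsLift ℓ lam) : Continuous lam := h.1.continuous

theorem a_apply (h : IsLift ℓ lam) (t : ℝ) : ℓ.1.a (lam t) = expCircle t := h.2.1 t

theorem one_eq (h : IsLift ℓ lam) : lam 1 = ℓ.1.act (lam 0) ℓ.diff :=
  ℓ.lift_one h.continuous h.a_apply

theorem add_intCast (h : IsLift ℓ lam) (t : ℝ) (k : ℤ) :
    lam (t + k) = ℓ.1.act (lam t) (ℓ.diff ^ k) :=
  StackMap.lift_add_intCast h.continuous
    (fun t => by rw [h.a_apply, h.a_apply, expCircle_add_one]) h.one_eq t k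

theorem isTwistedPath (h : IsLift ℓ lam) :
    IsTwistedPath (V := V) (X.bd ℓ.diff)⁻¹ (fun t => ℓ.1.b (lam t)) where
  smooth := ℓ.1.b_smooth.comp h.1
  zero := h.2.2
  add_one t := by
    have := h.add_intCast t 1
    rw [Int.cast_one, zpow_one] at this
    rw [this, ℓ.1.b_act]

end IsLift

/-- This is the compatibility of a twisted path with the power cocycle, needed for descent. -/
theorem apply_of_expCircle_eq {γ : Γ} {f : ℝ → G} (hf : ∀ t, f (t + 1) = (X.bd γ)⁻¹ * f t)
    {s t : ℝ} (h : expCircle s = expCircle t) :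
    f t = (X.bd (γ ^ round (t - s)))⁻¹ * f s := by
  obtain ⟨k, rfl⟩ := expCircle_eq_iff.mp h
  rw [apply_add_intCast hf, add_sub_cancel_left, round_intCast, map_zpow, inv_zpow]

/-- Every twisted path is the anchor of a lift of a loop. -/
theorem exists_loop [PreconnectedSpace G] {γ : Γ} {f : ℝ → G}
    (hf : IsTwistedPath (V := V) (X.bd γ)⁻¹ f) :
    ∃ (ℓ : X.Loop) (lam : ℝ → ℓ.1.E), IsLift ℓ lam ∧ (∀ t, ℓ.1.b (lam t) = f t) ∧
      ℓ.diff = γ := by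
  obtain ⟨P, σ, h1, h2, h3, h4⟩ := exists_stackMap_of_cocycle (I := 𝓡 1) (I' := 𝓘(ℝ, ℝ)) X
    isEtaleCover_expCircle (isCocycle_zpow γ) hf.smooth fun s t => apply_of_expCircle_eq hf.add_one
  have h0 : P.b (σ 0) = 1 := (h3 0).trans hf.zero
  let ℓ : X.Loop := ⟨P, twoIsoComp_unitMap_iff.mpr ⟨fun _ => σ 0, contMDiff_const,
    fun _ => (h2 0).trans expCircle_zero, fun _ => h0⟩⟩
  have hl : IsLift ℓ σ := ⟨h1, h2, h0⟩
  refine ⟨ℓ, σ, hl, h3, ?_⟩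
  -- The cocycle between `0` and `1` is `γ` itself, and it is the difference of the lift `σ`.
  have h5 := h4 0 1 (expCircle_zero.trans expCircle_one.symm)
  rw [sub_zero, round_one, zpow_one] at h5
  exact P.act_injective _ (hl.one_eq.symm.trans h5)

/-! ### Loops that are constant near the base point -/

/-- A local inverse of the universal cover followed by `lam` is a section with anchor `1`, that is,
a trivialisation by the unit. -/
theorem IsLift.constNearBase {ℓ : X.Loop} {lam : ℝ → ℓ.1.E} (h : IsLift ℓ lam)
    (h1 : ∀ᶠ t in 𝓝 0, ℓ.1.b (lam t) = 1) : ℓ.ConstNearBase := by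
  obtain ⟨φ, h0, hφ⟩ := isLocalHomeomorph_expCircle 0
  obtain ⟨O, hO1, hO, h0O⟩ := eventually_nhds_iff.mp h1
  have hφ0 : φ 0 = 1 := by rw [← hφ, expCircle_zero]
  refine ⟨⟨φ.target ∩ φ.symm ⁻¹' O, φ.symm.isOpen_inter_preimage hO⟩, ⟨?_, ?_⟩,
    twoIsoComp_unitMap_iff.mpr ⟨fun z => lam (φ.symm z), ?_, fun z => ?_, fun z => hO1 _ z.2.2⟩⟩
  · rw [← hφ0]
    exact φ.map_source h0
  · rw [Set.mem_preimage, ← hφ0, φ.left_inv h0]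
    exact h0O
  · refine contMDiff_of_comp_isLocalDiffeomorph ℓ.1.a_etale ?_ ?_
    · refine h.1.continuous.comp ?_
      exact φ.continuousOn_symm.comp_continuous continuous_subtype_val fun z => z.2.1
    · refine contMDiff_subtype_val.congr fun z => ?_
      refine (h.2.1 _).trans ?_
      change expCircle _ = _
      rw [hφ, φ.right_inv z.2.1]
  · refine (h.2.1 _).trans ?_
    change expCircle _ = _
    rw [hφ, φ.right_inv z.2.1]

/-- Start the lift on the given section of anchor `1`; as `a` is locally injective, the lift follows
this section for small `t`. -/
theorem Loop.ConstNearBase.exists_isLift {ℓ : X.Loop} (h : ℓ.ConstNearBase) :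
    ∃ lam, IsLift ℓ lam ∧ ∀ᶠ t in 𝓝 0, ℓ.1.b (lam t) = 1 := by
  obtain ⟨U, hU, h⟩ := h
  obtain ⟨σ, h1, h2, h3⟩ := twoIsoComp_unitMap_iff.mp h
  obtain ⟨lam, hlam, hlam0⟩ := ℓ.exists_isLift_of_base (h2 ⟨1, hU⟩) (h3 ⟨1, hU⟩)
  refine ⟨lam, hlam, ?_⟩
  obtain ⟨O, hO, h0O, hinj⟩ := ℓ.1.isLocalHomeomorph_a.isLocallyInjective (lam 0)
  have hσO : ∀ᶠ z in 𝓝 (1 : Circle), ∀ hz : z ∈ U, σ ⟨z, hz⟩ ∈ O := by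
    have h4 : σ ⁻¹' O ∈ 𝓝 (⟨1, hU⟩ : U) :=
      h1.continuous.continuousAt (hO.mem_nhds (by rwa [← hlam0]))
    obtain ⟨A, hA, hAO⟩ := mem_nhds_subtype _ _ _ |>.mp h4
    filter_upwards [hA] with z hz hzU
    exact hAO hz
  have hexp : Tendsto expCircle (𝓝 0) (𝓝 1) := by
    simpa only [expCircle_zero] using contMDiff_expCircle.continuous.tendsto 0
  filter_upwards [hexp hσO, hexp (U.isOpen.mem_nhds hU),
    hlam.1.continuous.continuousAt (hO.mem_nhds h0O)] with t h5 h6 h7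
  have h8 : lam t = σ ⟨expCircle t, h6⟩ := hinj h7 (h5 h6)
    ((hlam.2.1 t).trans (h2 ⟨expCircle t, h6⟩).symm)
  rw [h8, h3]

/-- This gives surjectivity of `∂₁` and, as the difference classifies loops, also the
representatives that are constant near the base point. -/
theorem exists_constNearBase_diff_eq [SimplyConnectedSpace G] (γ : Γ) :
    ∃ ℓ : X.Loop, ℓ.ConstNearBase ∧ ℓ.diff = γ := by
  have : IsTopologicalGroup G := topologicalGroup_of_lieGroup 𝓘(ℝ, V) ∞
  obtain ⟨f, hf, hf0, -⟩ := exists_isTwistedPath_near (V := V)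
    (PathConnectedSpace.somePath (1 : G) (X.bd γ)⁻¹) univ_mem
  obtain ⟨ℓ, lam, h1, h2, h3⟩ := exists_loop hf
  exact ⟨ℓ, h1.constNearBase (by simpa only [h2] using hf0), h3⟩

/-! ### Homotopies -/

/-- Lift the homotopy to `Λ` on `ℝ × ℝ`. The edges `Λ (0, ·)` and `Λ (1, ·)` lie over the same path,
so they differ by one element for all `r`; at `r = 0` and `r = 1` it is the difference of `ℓ₀` and
of `ℓ₁`. -/
theorem Homotopic.diff_eq [PreconnectedSpace G] {ℓ₀ ℓ₁ : X.Loop} (h : Homotopic ℓ₀ ℓ₁) :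
    ℓ₀.diff = ℓ₁.diff := by
  obtain ⟨F, -, h0, h1⟩ := h
  obtain ⟨e, he⟩ := F.a_surj (1, 0)
  obtain ⟨Λ, hΛ, hΛa, -⟩ := F.exists_lift (isEtaleCover_expCircle.prodMap_id).smooth (0, 0) e
    (by rw [he, Prod.map_apply, expCircle_zero])
  have hΛc := hΛ.continuous
  have key : ∀ (ℓ : X.Loop) (r : ℝ), TwoIsoComp (fun z : Circle => (z, r)) ℓ.1 F →
      Λ (1, r) = F.act (Λ (0, r)) ℓ.diff := by
    rintro ℓ r ⟨Φ, hΦ, hΦa, hΦact, -⟩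
    obtain ⟨lam, hlam⟩ := ℓ.exists_isLift
    refine StackMap.monodromy_eq (P := F) (lam := fun t => Φ (lam t))
      (lam' := fun t => Λ (t, r)) (hΦ.continuous.comp hlam.continuous)
      (hΛc.comp (by fun_prop)) (fun t => ?_) ?_
    · rw [hΦa, hΛa, hlam.a_apply, Prod.map_apply]
    · rw [hlam.one_eq, hΦact]
  have hr : ∀ r, Λ (1, r) = F.act (Λ (0, r)) ℓ₀.diff :=
    F.lift_unique (hΛc.comp (by fun_prop)) ((F.continuous_act _).comp (hΛc.comp (by fun_prop)))
      (fun r => by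
        rw [F.a_act, hΛa, hΛa,
          Prod.map_apply, Prod.map_apply, expCircle_zero, expCircle_one]) 0 (key ℓ₀ 0 h0)
  exact F.act_injective _ ((hr 1).symm.trans (key ℓ₁ 1 h1))

/-- The twisted paths of the two loops have the same factor, so they are smoothly homotopic; for
each `s` the homotopy is compatible with the same power cocycle, and it descends to `Circle × ℝ`. -/
theorem homotopic_of_diff_eq [SimplyConnectedSpace G] {ℓ₀ ℓ₁ : X.Loop}
    (h : ℓ₀.diff = ℓ₁.diff) : Homotopic ℓ₀ ℓ₁ := by
  obtain ⟨lam₀, hl₀⟩ := ℓ₀.exists_isLift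
  obtain ⟨lam₁, hl₁⟩ := ℓ₁.exists_isLift
  have ht₁ := hl₁.isTwistedPath
  rw [← h] at ht₁
  obtain ⟨f, hf, hf0, hf1, hfb, hfc⟩ := hl₀.isTwistedPath.homotopic ht₁
  have hcoc : ∀ x y : ℝ × ℝ, Prod.map expCircle (fun s : ℝ => s) x =
      Prod.map expCircle (fun s : ℝ => s) y →
      f y = (X.bd (ℓ₀.diff ^ round (y.1 - x.1)))⁻¹ * f x := by
    rintro ⟨t, s⟩ ⟨t', s'⟩ hxy
    obtain rfl : s = s' := congrArg Prod.snd hxy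
    exact apply_of_expCircle_eq (f := fun t => f (t, s)) (fun t => hfc t s)
      (congrArg Prod.fst hxy)
  obtain ⟨F, σ, hσ, hσa, hσb, hσc⟩ := exists_stackMap_of_cocycle (I := (𝓡 1).prod 𝓘(ℝ, ℝ)) X
    isEtaleCover_expCircle.prodMap_id (isCocycle_zpow ℓ₀.diff).prodMap_id hf hcoc
  have key : ∀ (ℓ : X.Loop) (r : ℝ) (lam : ℝ → ℓ.1.E), IsLift ℓ lam → ℓ.diff = ℓ₀.diff →
      (∀ t, f (t, r) = ℓ.1.b (lam t)) → TwoIsoComp (fun z : Circle => (z, r)) ℓ.1 F := by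
    intro ℓ r lam hl hdiff hfr
    refine twoIsoComp_of_lift ℓ.1 F isEtaleCover_expCircle hl.continuous hl.a_apply
      (mu := fun t => σ (t, r)) (hσ.comp (contMDiff_id.prodMk contMDiff_const))
      (fun t => hσa _) (fun t => (hσb _).trans (hfr t)) fun t t' γ hγ => ?_
    have hp : expCircle t = expCircle t' := by
      rw [← hl.a_apply, ← hl.a_apply, hγ, ℓ.1.a_act]
    have h1 := hσc (t, r) (t', r) (Prod.ext hp rfl)
    obtain ⟨k, rfl⟩ := expCircle_eq_iff.mp hp
    rw [hl.add_intCast] at hγ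
    rw [h1, ← ℓ.1.act_injective _ hγ, add_sub_cancel_left, round_intCast, hdiff]
  refine ⟨F, twoIsoComp_unitMap_iff.mpr ⟨fun s => σ (0, s), ?_, fun s => ?_, fun s => ?_⟩,
    key ℓ₀ 0 lam₀ hl₀ rfl hf0, key ℓ₁ 1 lam₁ hl₁ h.symm hf1⟩
  · exact hσ.comp (contMDiff_const.prodMk contMDiff_id)
  · rw [hσa, Prod.map_apply, expCircle_zero]
  · rw [hσb, hfb]

end DiscreteCrossedModule

end

noncomputable section

open Topology Filter

namespace DiscreteCrossedModule

variable {V : Type w} [NormedAddCommGroup V] [NormedSpace ℝ V]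
  {Γ : Type u} [Group Γ] {G : Type v} [TopologicalSpace G] [ChartedSpace V G] [Group G]
  [LieGroup 𝓘(ℝ, V) ∞ G] {X : DiscreteCrossedModule V Γ G}

/-! ### Half circles -/

theorem expCircle_coe_im (t : ℝ) : (expCircle t : ℂ).im = Real.sin (2 * Real.pi * t) := by
  rw [expCircle, Circle.coe_exp, Complex.exp_ofReal_mul_I_im]

theorem expCircle_half_coe : (expCircle (1 / 2) : ℂ) = -1 := by
  rw [expCircle, Circle.coe_exp]
  have : ((2 * Real.pi * (1 / 2) : ℝ) : ℂ) = Real.pi := by push_cast; ring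
  rw [this, Complex.exp_pi_mul_I]

theorem expCircle_coe_im_nonneg {t : ℝ} (ht : t ∈ Set.Icc 0 (1 / 2 : ℝ)) :
    0 ≤ (expCircle t : ℂ).im := by
  rw [expCircle_coe_im]
  apply Real.sin_nonneg_of_nonneg_of_le_pi
  · have := ht.1
    positivity
  · nlinarith [ht.2, Real.pi_pos]

theorem expCircle_coe_im_nonpos {t : ℝ} (ht : t ∈ Set.Icc (1 / 2 : ℝ) 1) :
    (expCircle t : ℂ).im ≤ 0 := by
  have h1 := expCircle_coe_im_nonneg (t := t - 1 / 2) ⟨by linarith [ht.1], by linarith [ht.2]⟩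
  have h2 : (expCircle t : ℂ) = expCircle (t - 1 / 2) * expCircle (1 / 2) := by
    rw [← Circle.coe_mul, ← expCircle_add, sub_add_cancel]
  rw [h2, expCircle_half_coe, mul_neg_one, Complex.neg_im]
  linarith

theorem exists_expCircle_of_im_nonneg {z : Circle} (hz : 0 ≤ (z : ℂ).im) :
    z ∈ expCircle '' Set.Icc 0 (1 / 2 : ℝ) := by
  refine ⟨Complex.arg z / (2 * Real.pi), ⟨?_, ?_⟩, ?_⟩
  · have := Complex.arg_nonneg_iff.mpr hz
    positivity
  · rw [div_le_iff₀ (by positivity)]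
    linarith [Complex.arg_le_pi z]
  · rw [expCircle, mul_div_cancel₀ _ (by positivity), Circle.exp_arg]

theorem exists_expCircle_of_im_nonpos {z : Circle} (hz : (z : ℂ).im ≤ 0) :
    z ∈ expCircle '' Set.Icc (1 / 2 : ℝ) 1 := by
  have h1 : 0 ≤ ((z * expCircle (1 / 2) : Circle) : ℂ).im := by
    rw [Circle.coe_mul, expCircle_half_coe, mul_neg_one, Complex.neg_im]
    linarith
  obtain ⟨t, ht, hzt⟩ := exists_expCircle_of_im_nonneg h1
  refine ⟨t + 1 / 2, ⟨by linarith [ht.1], by linarith [ht.2]⟩, ?_⟩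
  rw [expCircle_add, hzt, mul_assoc, ← expCircle_add, add_halves, expCircle_one, mul_one]

/-- The covering of the circle is injective on intervals of length less than one. -/
theorem eq_of_expCircle_eq {s t : ℝ} (h : expCircle s = expCircle t) (hst : |t - s| < 1) :
    s = t := by
  obtain ⟨k, rfl⟩ := expCircle_eq_iff.mp h
  rw [add_sub_cancel_left, ← Int.cast_abs] at hst
  have hk : |k| < 1 := by exact_mod_cast hst
  rw [Int.abs_lt_one_iff.mp hk, Int.cast_zero, add_zero]

/-- The arc has length `1/2`, so a point within `1/2` of `t` is at distance less than `1` from any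
point of the arc. This is the condition on `T` in `exists_bundleMap`. -/
theorem eventually_mem_of_expCircle_mem {x t : ℝ} (ht : t ∈ Set.Icc x (x + 1 / 2)) :
    ∀ᶠ s in 𝓝 t, expCircle s ∈ expCircle '' Set.Icc x (x + 1 / 2) → s ∈ Set.Icc x (x + 1 / 2) := by
  filter_upwards [Ioo_mem_nhds (show t - 1 / 2 < t by linarith) (show t < t + 1 / 2 by linarith)]
    with s hs
  rintro ⟨r, hr, hrs⟩
  rwa [← eq_of_expCircle_eq hrs (by
    rw [abs_lt]; constructor <;> linarith [hs.1, hs.2, hr.1, hr.2, ht.1, ht.2])]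

/-- Isomorphisms with the pullback along the squaring map over a half circle. -/
theorem exists_isSquareIsoOn {P Q : X.StackMap (𝓡 1) Circle} {lam : ℝ → P.E}
    (hlam : Continuous lam) (hlama : ∀ t, P.a (lam t) = expCircle t) {mu : ℝ → Q.E}
    (hmu : ContMDiff 𝓘(ℝ, ℝ) (𝓡 1) ∞ mu) (hmua : ∀ t, Q.a (mu t) = expCircle (2 * t)) {x : ℝ}
    (hb : ∀ t ∈ Set.Icc x (x + 1 / 2), Q.b (mu t) = P.b (lam t)) {S : Set Circle}
    (hS : S ⊆ expCircle '' Set.Icc x (x + 1 / 2)) :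
    ∃ Φ : P.E → Q.E, IsSquareIsoOn S P Q Φ ∧
      ∀ t ∈ Set.Icc x (x + 1 / 2), ∀ γ, Φ (P.act (lam t) γ) = Q.act (mu t) γ := by
  obtain ⟨Φ, h1, h2, h3⟩ := exists_bundleMap P Q (f := fun z => z ^ 2) isEtaleCover_expCircle hlam
    hlama hmu (fun t ht => eventually_mem_of_expCircle_mem ht)
    (fun t _ => (hmua t).trans (expCircle_sq t).symm) hb (fun t ht t' ht' γ h => by
      have hp : expCircle t = expCircle t' := by rw [← hlama, ← hlama, h, P.a_act]
      -- The cover is injective on the arc, so compatibility only has to be checked for `γ = 1`.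
      obtain rfl := eq_of_expCircle_eq hp (by
        rw [abs_lt]; constructor <;> linarith [ht.1, ht.2, ht'.1, ht'.2])
      rw [← P.act_injective _ ((P.act_one _).trans h), Q.act_one])
  refine ⟨Φ, ⟨h1.mono (Set.preimage_mono hS), fun e he => h2 e (hS he)⟩, fun t ht γ => ?_⟩
  rw [(h2 (lam t) ⟨t, ht, (hlama t).symm⟩).2.1, h3 t ht]

/-! ### Concatenation -/

/-- Concatenation of twisted paths that are constant near `0`. -/
theorem IsTwistedPath.exists_concat {c₀ c₁ : G} {f₀ f₁ : ℝ → G}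
    (h₀ : IsTwistedPath (V := V) c₀ f₀) (h₁ : IsTwistedPath (V := V) c₁ f₁)
    (hf₀ : ∀ᶠ t in 𝓝 0, f₀ t = 1) (hf₁ : ∀ᶠ t in 𝓝 0, f₁ t = 1) :
    ∃ f, IsTwistedPath (V := V) (c₀ * c₁) f ∧
      (∀ t ∈ Set.Icc 0 (1 / 2 : ℝ), f t = f₀ (2 * t)) ∧
      ∀ t ∈ Set.Icc (1 / 2 : ℝ) 1, f t = c₀ * f₁ (2 * t - 1) := by
  obtain ⟨g₀, hg₀, hgf₀, ε₀, hε₀, h01, h0c⟩ := h₀.exists_flat hf₀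
  obtain ⟨g₁, hg₁, hgf₁, ε₁, hε₁, h11, h1c⟩ := h₁.exists_flat hf₁
  -- Since `g₀` rests at `c₀` from time `1` on and `g₁` at `1` until time `0`, the product runs
  -- through the two paths in turn.
  have hg : ContMDiff 𝓘(ℝ, ℝ) 𝓘(ℝ, V) ∞ (fun t => g₀ (2 * t) * g₁ (2 * t - 1)) :=
    (hg₀.comp (contDiff_const.mul contDiff_id).contMDiff).mul
      (hg₁.comp ((contDiff_const.mul contDiff_id).sub contDiff_const).contMDiff)
  let ε : ℝ := min (min (ε₀ / 2) (ε₁ / 2)) (1 / 2)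
  have hε : 0 < ε := by positivity
  have he0 : ε ≤ ε₀ / 2 := (min_le_left _ _).trans (min_le_left _ _)
  have he1 : ε ≤ ε₁ / 2 := (min_le_left _ _).trans (min_le_right _ _)
  have he2 : ε ≤ 1 / 2 := min_le_right _ _
  obtain ⟨f, hf, hfg, -⟩ := exists_isTwistedPath_of_flat (c := c₀ * c₁) hg hε
    (fun t ht => by simp only [h01 (2 * t) (by linarith), h11 (2 * t - 1) (by linarith), one_mul])
    (fun t ht => by simp only [h0c (2 * t) (by linarith), h1c (2 * t - 1) (by linarith)])
  refine ⟨f, hf, fun t ht => ?_, fun t ht => ?_⟩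
  · rw [hfg t ⟨ht.1, by linarith [ht.2]⟩]
    simp only [h11 (2 * t - 1) (by linarith [ht.2]), mul_one]
    exact hgf₀ _ ⟨by linarith [ht.1], by linarith [ht.2]⟩
  · rw [hfg t ⟨by linarith [ht.1], ht.2⟩]
    simp only [h0c (2 * t) (by linarith [ht.1]), mul_right_inj]
    exact hgf₁ _ ⟨by linarith [ht.1], by linarith [ht.2]⟩

theorem exists_isConcat [PreconnectedSpace G] {ℓ₀ ℓ₁ : X.Loop} (h₀ : ℓ₀.ConstNearBase)
    (h₁ : ℓ₁.ConstNearBase) : ∃ ℓ : X.Loop, IsConcat ℓ₀ ℓ₁ ℓ := by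
  obtain ⟨lam₀, hl₀, hc₀⟩ := h₀.exists_isLift
  obtain ⟨lam₁, hl₁, hc₁⟩ := h₁.exists_isLift
  obtain ⟨f, hf, hf0, hf1⟩ := hl₀.isTwistedPath.exists_concat hl₁.isTwistedPath hc₀ hc₁
  rw [← mul_inv_rev, ← map_mul] at hf
  obtain ⟨ℓ, lam, hl, hlb, hdiff⟩ := exists_loop hf
  obtain ⟨Φ₀, hΦ₀, hΦ₀'⟩ := exists_isSquareIsoOn (P := ℓ.1) (Q := ℓ₀.1) hl.continuous hl.a_apply
    (mu := fun t => lam₀ (2 * t)) (hl₀.1.comp (contDiff_const.mul contDiff_id).contMDiff)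
    (fun t => hl₀.a_apply _) (x := 0) (S := {z | 0 ≤ (z : ℂ).im})
    (fun t ht => by
      rw [zero_add] at ht
      rw [hlb, hf0 t ht])
    (fun z hz => by
      rw [zero_add]
      exact exists_expCircle_of_im_nonneg hz)
  obtain ⟨Φ₁, hΦ₁, hΦ₁'⟩ := exists_isSquareIsoOn (P := ℓ.1) (Q := ℓ₁.1) hl.continuous hl.a_apply
    -- On the second half the concatenated path carries the factor `∂(γ₀)⁻¹`, with `γ₀ = ℓ₀.diff`;
    -- translating the lift by `γ₀` gives its anchor the same factor.
    (mu := fun t => ℓ₁.1.act (lam₁ (2 * t - 1)) ℓ₀.diff)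
    ((ℓ₁.1.act_smooth _).comp
      (hl₁.1.comp ((contDiff_const.mul contDiff_id).sub contDiff_const).contMDiff))
    (fun t => by
      rw [ℓ₁.1.a_act, hl₁.a_apply, ← expCircle_add_one, sub_add_cancel])
    (x := 1 / 2) (S := {z | (z : ℂ).im ≤ 0})
    (fun t ht => by
      rw [add_halves] at ht
      rw [hlb, hf1 t ht, ℓ₁.1.b_act])
    (fun z hz => by
      rw [add_halves]
      exact exists_expCircle_of_im_nonpos hz)
  -- `lam (1 / 2)` goes to `lam₀ 1` and to `lam₁ 0 · ℓ₀.diff`; translating back by `ℓ₀.diff` yields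
  -- both base points at once.
  refine ⟨ℓ, Φ₀, Φ₁, hΦ₀, hΦ₁, lam₀ 0, lam₁ 0, lam 0, ℓ.1.act (lam (1 / 2)) ℓ₀.diff⁻¹,
    by rw [hl₀.a_apply, expCircle_zero], hl₀.2.2, by rw [hl₁.a_apply, expCircle_zero], hl₁.2.2,
    by rw [hl.a_apply, expCircle_zero]; rfl,
    by rw [ℓ.1.a_act, hl.a_apply, expCircle_half_coe], ?_, ?_, ?_, ?_⟩
  · have := hΦ₀' 0 ⟨le_rfl, by norm_num⟩ 1
    rwa [ℓ.1.act_one, ℓ₀.1.act_one, mul_zero] at this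
  -- `Φ₁` is known only along `[1/2, 1]`, so `lam 0` is written as `lam 1` translated by the inverse
  -- of the difference.
  · have h := hΦ₁' 1 ⟨by norm_num, by norm_num⟩ ℓ.diff⁻¹
    have h1 : (2 * 1 - 1 : ℝ) = 1 := by norm_num
    rw [hl.one_eq, ℓ.1.act_act_inv, h1, hl₁.one_eq, hdiff, mul_inv_rev,
      ℓ₁.1.act_mul, ℓ₁.1.act_act_inv, ℓ₁.1.act_act_inv] at h
    exact h
  · rw [hΦ₀' _ ⟨by norm_num, by norm_num⟩, mul_one_div_cancel two_ne_zero, hl₀.one_eq,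
      ℓ₀.1.act_act_inv]
  · rw [hΦ₁' _ ⟨by norm_num, by norm_num⟩, mul_one_div_cancel two_ne_zero, sub_self,
      ℓ₁.1.act_act_inv]

/-- Follow a lift of `ℓ` through both identifications. Along the first half it becomes a lift of
`ℓ₀`, so at `1/2` it has moved away from `e'` by `ℓ₀.diff`; along the second half it becomes a lift
of `ℓ₁` translated by that element. -/
theorem IsConcat.diff_eq [PreconnectedSpace G] {ℓ₀ ℓ₁ ℓ : X.Loop} (h : IsConcat ℓ₀ ℓ₁ ℓ) :
    ℓ.diff = ℓ₀.diff * ℓ₁.diff := by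
  obtain ⟨Φ₀, Φ₁, ⟨hs₀, hΦ₀⟩, ⟨hs₁, hΦ₁⟩, e₀, e₁, e, e', ha₀, hb₀, ha₁, hb₁, he, he', h0, h1, h0',
    h1'⟩ := h
  have hea : ℓ.1.a e = 1 := Circle.ext he
  have hea' : ℓ.1.a e' = expCircle (1 / 2) := Circle.ext (he'.trans expCircle_half_coe.symm)
  obtain ⟨lam₀, hl₀, hl₀0⟩ := ℓ₀.exists_isLift_of_base ha₀ hb₀
  obtain ⟨lam₁, hl₁, hl₁0⟩ := ℓ₁.exists_isLift_of_base ha₁ hb₁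
  obtain ⟨lam, hl, hla, hl0⟩ := ℓ.1.exists_lift contMDiff_expCircle 0 e
    (hea.trans expCircle_zero.symm)
  have hlc := hl.continuous
  obtain ⟨κ, hκ⟩ := ℓ.1.exists_act (hea'.trans (hla _).symm)
  have hmem₀ : ∀ t ∈ Set.Icc 0 (1 / 2 : ℝ), ℓ.1.a (lam t) ∈ {z : Circle | 0 ≤ (z : ℂ).im} :=
    fun t ht => by
      rw [hla]
      exact expCircle_coe_im_nonneg ht
  have hmem₁ : ∀ t ∈ Set.Icc (1 / 2 : ℝ) 1, ℓ.1.a (lam t) ∈ {z : Circle | (z : ℂ).im ≤ 0} :=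
    fun t ht => by
      rw [hla]
      exact expCircle_coe_im_nonpos ht
  have hhalf : ∀ s : Set Circle, ℓ.1.a (lam (1 / 2)) ∈ s → ℓ.1.a e' ∈ s := fun s hs => by
    rwa [hea', ← hla]
  have first : Φ₀ (lam (1 / 2)) = lam₀ (2 * (1 / 2)) := by
    refine ℓ₀.1.isCoveringMap_a.eqOn_of_comp_eqOn (s := Set.Icc 0 (1 / 2 : ℝ))
      (g₁ := fun t => Φ₀ (lam t)) (g₂ := fun t => lam₀ (2 * t)) isPreconnected_Icc
      (hs₀.continuousOn.comp hlc.continuousOn hmem₀)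
      (hl₀.continuous.comp (by fun_prop)).continuousOn (fun t ht => ?_)
      (a := 0) ⟨le_rfl, by norm_num⟩ ?_ ⟨by norm_num, le_rfl⟩
    · simp only [Function.comp_apply]
      rw [(hΦ₀ _ (hmem₀ t ht)).1, hla, hl₀.a_apply, expCircle_sq]
    · simp only [mul_zero]
      rw [hl0, hl₀0, h0]
  have hκ₀ : κ = ℓ₀.diff := by
    rw [mul_one_div_cancel two_ne_zero, hl₀.one_eq, hκ,
      (hΦ₀ e' (hhalf _ (hmem₀ _ ⟨by norm_num, le_rfl⟩))).2.1, h0', hl₀0] at first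
    exact ℓ₀.1.act_injective _ first
  have second : Φ₁ (lam 1) = ℓ₁.1.act (lam₁ (2 * 1 - 1)) κ := by
    refine ℓ₁.1.isCoveringMap_a.eqOn_of_comp_eqOn (s := Set.Icc (1 / 2 : ℝ) 1)
      (g₁ := fun t => Φ₁ (lam t)) (g₂ := fun t => ℓ₁.1.act (lam₁ (2 * t - 1)) κ)
      isPreconnected_Icc (hs₁.continuousOn.comp hlc.continuousOn hmem₁)
      ((ℓ₁.1.continuous_act κ).comp (hl₁.continuous.comp (by fun_prop))).continuousOn
      (fun t ht => ?_) (a := 1 / 2) ⟨le_rfl, by norm_num⟩ ?_ ⟨by norm_num, le_rfl⟩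
    · simp only [Function.comp_apply]
      rw [(hΦ₁ _ (hmem₁ t ht)).1, hla, ℓ₁.1.a_act, hl₁.a_apply, expCircle_sq,
        ← expCircle_add_one (2 * t - 1), sub_add_cancel]
    · rw [hκ, (hΦ₁ e' (hhalf _ (hmem₁ _ ⟨le_rfl, by norm_num⟩))).2.1, h1',
        mul_one_div_cancel two_ne_zero, sub_self, hl₁0]
  have hone : (2 * 1 - 1 : ℝ) = 1 := by norm_num
  have hea1 : ℓ.1.a e ∈ {z : Circle | (z : ℂ).im ≤ 0} := by
    rw [hea, ← expCircle_one]
    exact expCircle_coe_im_nonpos ⟨by norm_num, le_rfl⟩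
  rw [hone, hl₁.one_eq, ℓ.lift_one hlc hla, hl0, (hΦ₁ e hea1).2.1, h1, hl₁0, ← ℓ₁.1.act_mul,
    hκ₀] at second
  -- The computation yields `ℓ₁.diff * ℓ₀.diff`; commutativity puts the factors in the stated order.
  rw [ℓ₁.1.act_injective _ second, X.mul_comm_of_preconnected]

/-! ### The bijection and the transported group structure -/

/-- The boundary map `π₁(𝒢) → Γ`, as a bijection. -/
def piOneEquiv [SimplyConnectedSpace G] (X : DiscreteCrossedModule V Γ G) : X.PiOne ≃ Γ :=
  Equiv.ofBijective (Quot.lift (fun ℓ : X.Loop => ℓ.diff) fun _ _ h => h.diff_eq) (by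
    constructor
    · rintro ⟨ℓ₀⟩ ⟨ℓ₁⟩ h
      exact Quot.sound (homotopic_of_diff_eq h)
    · intro γ
      obtain ⟨ℓ, -, hℓ⟩ := exists_constNearBase_diff_eq (X := X) γ
      exact ⟨ℓ.toPiOne, hℓ⟩)

end DiscreteCrossedModule

end

theorem mainTheorem5 {V : Type w} [NormedAddCommGroup V] [NormedSpace ℝ V] [FiniteDimensional ℝ V]
    {Γ : Type u} [Group Γ] {G : Type v} [TopologicalSpace G] [ChartedSpace V G] [Group G]
    [LieGroup 𝓘(ℝ, V) ∞ G] [SimplyConnectedSpace G] (X : DiscreteCrossedModule V Γ G) :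
    -- homotopy is an equivalence relation on loops
    Equivalence (DiscreteCrossedModule.Homotopic (X := X)) ∧
    -- every class has a representative that is constant near the base point
    (∀ c : X.PiOne, ∃ ℓ : X.Loop, ℓ.ConstNearBase ∧ ℓ.toPiOne = c) ∧
    -- such representatives can be concatenated
    (∀ ℓ₀ ℓ₁ : X.Loop, ℓ₀.ConstNearBase → ℓ₁.ConstNearBase →
      ∃ ℓ : X.Loop, DiscreteCrossedModule.IsConcat ℓ₀ ℓ₁ ℓ) ∧
    -- every loop has a lift through the unit
    (∀ ℓ : X.Loop, ∃ lam : ℝ → ℓ.1.E, DiscreteCrossedModule.IsLift ℓ lam) ∧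
    -- concatenation is the multiplication of a group structure on `π₁(𝒢)`, for which the
    -- boundary map is well defined and an isomorphism of groups
    ∃ _ : Group X.PiOne,
      (∀ ℓ₀ ℓ₁ ℓ : X.Loop, DiscreteCrossedModule.IsConcat ℓ₀ ℓ₁ ℓ →
        ℓ₀.toPiOne * ℓ₁.toPiOne = ℓ.toPiOne) ∧
      ∃ bdOne : X.PiOne ≃* Γ, ∀ (ℓ : X.Loop) (lam : ℝ → ℓ.1.E),
        DiscreteCrossedModule.IsLift ℓ lam → lam 1 = ℓ.1.act (lam 0) (bdOne ℓ.toPiOne) := by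
  refine ⟨⟨fun ℓ => DiscreteCrossedModule.homotopic_of_diff_eq rfl,
    fun h => DiscreteCrossedModule.homotopic_of_diff_eq h.diff_eq.symm,
    fun h h' => DiscreteCrossedModule.homotopic_of_diff_eq (h.diff_eq.trans h'.diff_eq)⟩,
    fun c => ?_, fun ℓ₀ ℓ₁ => DiscreteCrossedModule.exists_isConcat,
    fun ℓ => ℓ.exists_isLift, X.piOneEquiv.group, fun ℓ₀ ℓ₁ ℓ h => ?_, ?_⟩
  · obtain ⟨ℓ, hc, hℓ⟩ :=
      DiscreteCrossedModule.exists_constNearBase_diff_eq (X := X) (X.piOneEquiv c)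
    exact ⟨ℓ, hc, X.piOneEquiv.injective hℓ⟩
  -- The product of classes is by definition the class whose difference is the product, and a
  -- concatenation has that difference.
  · refine X.piOneEquiv.injective ?_
    refine (X.piOneEquiv.apply_symm_apply _).trans ?_
    exact h.diff_eq.symm
  · let : Group X.PiOne := X.piOneEquiv.group
    exact ⟨X.piOneEquiv.mulEquiv, fun ℓ lam h => h.one_eq⟩
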